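/- Let $1\le p\le\infty$, let $\Omega\subseteq\mathbb{R}^N$ be open and let $u\in C^2(\Omega)$. For $x\in\Omega$ and $\varepsilon>0$ with $\overline{B_\varepsilon(x)}\subset\Omega$ there is a unique real number $\mu_p(\varepsilon,u)(x)$ such that $$\Vert u-\mu_p(\varepsilon,u)(x)\Vert_{L^p(\overline{B_\varepsilon(x)})}=\min_{\lambda\in\mathbb{R}}\Vert u-\lambda\Vert_{L^p(\overline{B_\varepsilon(x)})},$$ where the norms are taken with respect to Lebesgue measure. At points where $\nabla u\ne0$, let $$\Delta_p^n u=\frac{\operatorname{div}\left(|\nabla u|^{p-2}\nabla u\right)}{|\nabla u|^{p-2}}\quad(1\le p<\infty),\qquad \Delta_\infty^n u=\frac{\langle\nabla^2u\,\nabla u,\nabla u\rangle}{|\nabla u|^2}.$$ Then, for every $x\in\Omega$ such that $\nabla u(x)\neq0$, the following are equivalent: (i) $\Delta_p^n u(x)=0$; (ii) $u(x)=\mu_p(\varepsilon,u)(x)+o(\varepsilon^2)$ as $\varepsilon\to0^+$. In particular, (i) holds at all $x\in\Omega$ with $\nabla u(x)\neq0$ if and only if (ii) holds at all such $x$. -/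

import Mathlib

open MeasureTheory Topology Asymptotics Filter
open scoped ENNReal

namespace PMeanValue

/-- The divergence `∑ i, ∂ᵢ Vᵢ` of a vector field `V` on `ℝ^N` at the point `x`. -/
noncomputable def divergence {N : ℕ}
    (V : EuclideanSpace ℝ (Fin N) → EuclideanSpace ℝ (Fin N)) (x : EuclideanSpace ℝ (Fin N)) : ℝ :=
  ∑ i : Fin N, (fderiv ℝ V x (EuclideanSpace.single i 1)) i

/-- The normalized `p`-Laplacian of `u` at `x`: it is `div(|∇u|^(p-2) ∇u) / |∇u|^(p-2)` for
`p < ∞`, and `⟨∇²u ∇u, ∇u⟩ / |∇u|^2` for `p = ∞`, where the Hessian `∇²u` is the derivative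
of the gradient. It is meaningful at points where `∇u(x) ≠ 0`. -/
noncomputable def normalizedPLaplacian {N : ℕ} (p : ℝ≥0∞)
    (u : EuclideanSpace ℝ (Fin N) → ℝ) (x : EuclideanSpace ℝ (Fin N)) : ℝ :=
  if p = ∞ then
    inner ℝ (fderiv ℝ (gradient u) x (gradient u x)) (gradient u x) / ‖gradient u x‖ ^ 2
  else
    divergence (fun y => ‖gradient u y‖ ^ (p.toReal - 2) • gradient u y) x
      / ‖gradient u x‖ ^ (p.toReal - 2)

/-- `m` minimizes `c ↦ ‖u - c‖` in `L^p` of the closed ball of centre `x` and radius `ε`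
(with Lebesgue measure) over all real constants `c`. -/
def IsPMean {N : ℕ} (p : ℝ≥0∞) (u : EuclideanSpace ℝ (Fin N) → ℝ)
    (x : EuclideanSpace ℝ (Fin N)) (ε : ℝ) (m : ℝ) : Prop :=
  ∀ c : ℝ, eLpNorm (fun y => u y - m) p (volume.restrict (Metric.closedBall x ε)) ≤
    eLpNorm (fun y => u y - c) p (volume.restrict (Metric.closedBall x ε))

/-- The `p`-mean `μ_p(ε, u)(x)`: the minimizing constant on the closed ball
of centre `x` and radius `ε`. -/
noncomputable def pMean {N : ℕ} (p : ℝ≥0∞) (u : EuclideanSpace ℝ (Fin N) → ℝ)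
    (x : EuclideanSpace ℝ (Fin N)) (ε : ℝ) : ℝ :=
  Classical.epsilon (IsPMean p u x ε)

end PMeanValue

/-!
At a point `x` with `∇u(x) ≠ 0` the `p`-mean has the expansion
`μ_p(ε, u)(x) = u(x) + κ Δ_pⁿ u(x) ε² + o(ε²)` for some `κ > 0` depending only on `p` and the
dimension (`exists_tendsto_pMean`), and both directions of the equivalence can be read off from it.

For `p < ∞` write `φ(t) = sign t * |t| ^ (p - 1)` (`signedPow`), a subgradient of `|t| ^ p / p`,
also for `p = 1`. By convexity, the sign of `∫ φ(u - c)` over the ball decides on which side of `c`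
the `p`-mean lies (`IsPMean.le_of_integral_pos`, `IsPMean.le_of_integral_neg`). As `φ` is monotone,
`u` may be replaced by its second-order Taylor polynomial up to an error `η ε²`, and after rescaling
it remains to find the first-order behaviour in `ε` of
`∫ φ(⟪e, z⟫ + ε (⟪A z, z⟫ / 2 - a))` over the unit ball, where `e = ∇u(x) / |∇u(x)|`.
Differentiating under the integral would produce the weight `|⟪e, z⟫| ^ (p - 2)`, which is not
integrable for `p = 1`. Instead, one integrates over chords parallel to `e`: on a chord the argument `w` of `φ` has
derivative close to `1`, and `p φ(w) w'` is the derivative of `|w| ^ p`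
(`integral_signedPow_mul_deriv`), so the leading term becomes a difference of boundary values, which
is easily expanded. This works for all `1 ≤ p < ∞` simultaneously. The resulting integrals over the
equatorial ball are related to each other by an integration by parts
(`integral_signedPow_halfChord_mul_inner`), and the outcome is a positive multiple of
`tr A + (p - 2) ⟪A e, e⟫`, which is `Δ_pⁿ u(x)`, minus a positive multiple of `a`.

For `p = ∞` the mean is the mid-range, and the maximum and the minimum of `u` are attained, up to
`o(ε²)`, at the poles `x ± ε e`.

Existence of the `p`-mean follows from compactness, as constants outside of the range of `u` are
never better than its end points. If there were two minimizers, `∫ φ(u - c)` would vanish for all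
`c` between them, which is impossible since the ball is connected.
-/

namespace PMeanValue

/-! ### Signed powers -/

/-- The odd power `sign t * |t| ^ (r - 1)`, which is `|t| ^ (r - 2) * t` for `t ≠ 0`. Up to the
factor `r` it is the derivative of `|t| ^ r`; it vanishes at `0`, also for `r = 1`, where it is
the sign function. -/
noncomputable def signedPow (r t : ℝ) : ℝ := Real.sign t * |t| ^ (r - 1)

section SignedPow

variable {r : ℝ}

@[simp] lemma signedPow_zero : signedPow r 0 = 0 := by simp [signedPow]

lemma signedPow_of_pos {t : ℝ} (ht : 0 < t) : signedPow r t = t ^ (r - 1) := by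
  simp [signedPow, Real.sign_of_pos ht, abs_of_pos ht]

lemma signedPow_neg (t : ℝ) : signedPow r (-t) = -signedPow r t := by
  simp [signedPow, Real.sign_neg]

lemma signedPow_nonneg {t : ℝ} (ht : 0 ≤ t) : 0 ≤ signedPow r t := by
  rcases ht.eq_or_lt with rfl | h
  · simp
  · rw [signedPow_of_pos h]; positivity

lemma signedPow_pos {t : ℝ} (ht : 0 < t) : 0 < signedPow r t := by
  rw [signedPow_of_pos ht]; positivity

lemma signedPow_mul {c : ℝ} (hc : 0 < c) (t : ℝ) :
    signedPow r (c * t) = c ^ (r - 1) * signedPow r t := by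
  rcases lt_trichotomy t 0 with h | rfl | h
  · have h' : 0 < -t := by linarith
    have e : c * t = -(c * -t) := by ring
    have e' : signedPow r t = -signedPow r (-t) := by rw [signedPow_neg]; ring
    rw [e', e, signedPow_neg, signedPow_of_pos (by positivity), signedPow_of_pos h',
      Real.mul_rpow hc.le h'.le]
    ring
  · simp
  · rw [signedPow_of_pos (by positivity), signedPow_of_pos h, Real.mul_rpow hc.le h.le]

lemma abs_signedPow_le (t : ℝ) : |signedPow r t| ≤ |t| ^ (r - 1) := by
  have h0 : 0 ≤ |t| ^ (r - 1) := by positivity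
  rw [signedPow, abs_mul, abs_of_nonneg h0]
  refine mul_le_of_le_one_left h0 ?_
  rcases Real.sign_apply_eq t with h | h | h <;> simp [h]

lemma monotone_signedPow (hr : 1 ≤ r) : Monotone (signedPow r) := by
  have hpos : ∀ s t : ℝ, 0 ≤ s → s ≤ t → signedPow r s ≤ signedPow r t := by
    intro s t hs hst
    rcases hs.eq_or_lt with rfl | h
    · simpa using signedPow_nonneg hst
    · rw [signedPow_of_pos h, signedPow_of_pos (h.trans_le hst)]
      exact Real.rpow_le_rpow hs hst (by linarith)
  intro s t hst
  rcases le_total 0 s with hs | hs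
  · exact hpos s t hs hst
  rcases le_total 0 t with ht | ht
  · refine le_trans ?_ (signedPow_nonneg ht)
    have := signedPow_nonneg (r := r) (neg_nonneg.2 hs)
    rw [signedPow_neg] at this
    linarith
  · have := hpos (-t) (-s) (by linarith) (by linarith)
    rw [signedPow_neg, signedPow_neg] at this
    linarith

lemma measurable_signedPow (hr : 1 ≤ r) : Measurable (signedPow r) :=
  (monotone_signedPow hr).measurable

lemma abs_signedPow_le_of_abs_le (hr : 1 ≤ r) {t R : ℝ} (h : |t| ≤ R) :
    |signedPow r t| ≤ R ^ (r - 1) :=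
  (abs_signedPow_le t).trans (Real.rpow_le_rpow (abs_nonneg _) h (by linarith))

lemma signedPow_mul_self {t : ℝ} (hr : 1 ≤ r) : signedPow r t * t = |t| ^ r := by
  have hpos : ∀ s : ℝ, 0 < s → signedPow r s * s = |s| ^ r := by
    intro s hs
    rw [signedPow_of_pos hs, abs_of_pos hs, ← Real.rpow_add_one hs.ne']
    congr 1; ring
  rcases lt_trichotomy t 0 with h | rfl | h
  · have := hpos (-t) (by linarith)
    rw [signedPow_neg, abs_neg] at this
    linarith
  · simp [Real.zero_rpow (by linarith : r ≠ 0)]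
  · exact hpos t h

lemma hasDerivAt_abs_rpow {t : ℝ} (ht : t ≠ 0) :
    HasDerivAt (fun s : ℝ => |s| ^ r) (r * signedPow r t) t := by
  have := (hasDerivAt_abs ht).rpow_const (p := r) (Or.inl (abs_ne_zero.2 ht))
  refine this.congr_deriv ?_
  have e : (SignType.sign t : ℝ) = Real.sign t := by
    rcases lt_or_gt_of_ne ht with h | h
    · simp [Real.sign_of_neg h, h]
    · simp [Real.sign_of_pos h, h]
  rw [signedPow, e]; ring

lemma continuousAt_signedPow {t : ℝ} (ht : t ≠ 0) : ContinuousAt (signedPow r) t := by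
  rcases lt_or_gt_of_ne ht with h | h
  · have : ContinuousAt (fun s : ℝ => -(-s) ^ (r - 1)) t :=
      (continuousAt_neg.rpow_const (Or.inl (by linarith))).neg
    refine this.congr ?_
    filter_upwards [Iio_mem_nhds h] with s hs
    have hs' : 0 < -s := neg_pos.2 hs
    rw [← signedPow_of_pos hs', signedPow_neg, neg_neg]
  · have : ContinuousAt (fun s : ℝ => s ^ (r - 1)) t :=
      continuousAt_id.rpow_const (Or.inl ht)
    refine this.congr ?_
    filter_upwards [Ioi_mem_nhds h] with s hs
    rw [signedPow_of_pos hs]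

/-- `r * signedPow r t` is a subgradient of the convex function `|·| ^ r` at `t`. -/
lemma abs_rpow_add_le (hr : 1 ≤ r) (s t : ℝ) :
    |t| ^ r + r * signedPow r t * (s - t) ≤ |s| ^ r := by
  have hpos : ∀ s t : ℝ, 0 < t → |t| ^ r + r * signedPow r t * (s - t) ≤ |s| ^ r := by
    intro s t ht
    -- Bernoulli's inequality at `|s| / t`
    have hb := one_add_mul_self_le_rpow_one_add (s := |s| / t - 1)
      (by have : 0 ≤ |s| / t := by positivity
          linarith) hr
    have e : (1 : ℝ) + (|s| / t - 1) = |s| / t := by ring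
    rw [e, Real.div_rpow (abs_nonneg s) ht.le, le_div_iff₀ (by positivity)] at hb
    have hS : t ^ r = signedPow r t * t := by
      rw [signedPow_mul_self hr, abs_of_pos ht]
    rw [abs_of_pos ht]
    have h1 : r * signedPow r t * (s - t) ≤ r * signedPow r t * (|s| - t) := by
      gcongr
      · have := signedPow_pos (r := r) ht
        positivity
      · exact le_abs_self s
    have h2 : (1 + r * (|s| / t - 1)) * t ^ r = t ^ r + r * signedPow r t * (|s| - t) := by
      rw [hS]; field_simp
    linarith
  rcases lt_trichotomy t 0 with h | rfl | h
  · have := hpos (-s) (-t) (by linarith)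
    rw [signedPow_neg, abs_neg, abs_neg] at this
    linarith
  · have : 0 ≤ |s| ^ r := by positivity
    simpa [Real.zero_rpow (by linarith : r ≠ 0)] using this
  · exact hpos s t h

lemma abs_abs_rpow_sub_le (hr : 1 ≤ r) {s t R : ℝ} (hs : |s| ≤ R) (ht : |t| ≤ R) :
    |(|s| ^ r - |t| ^ r)| ≤ r * R ^ (r - 1) * |s - t| := by
  have key : ∀ s t : ℝ, |t| ≤ R → |t| ^ r - |s| ^ r ≤ r * R ^ (r - 1) * |s - t| := by
    intro s t ht
    have h1 := abs_rpow_add_le hr s t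
    have h2 : -(r * signedPow r t * (s - t)) ≤ r * R ^ (r - 1) * |s - t| := by
      refine (neg_le_abs _).trans ?_
      rw [abs_mul, abs_mul, abs_of_nonneg (by linarith : 0 ≤ r)]
      gcongr
      exact abs_signedPow_le_of_abs_le hr ht
    linarith
  have h1 := key s t ht
  have h2 := key t s hs
  rw [abs_sub_comm t s] at h2
  exact abs_le.2 ⟨by linarith, h2⟩

lemma continuous_abs_rpow (hr : 1 ≤ r) : Continuous (fun s : ℝ => |s| ^ r) :=
  continuous_abs.rpow_const (fun _ => Or.inr (by linarith))

end SignedPow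

/-! ### Integrals along a chord -/

section Slice

variable {r : ℝ}

lemma intervalIntegrable_signedPow_comp (hr : 1 ≤ r) {w : ℝ → ℝ} (hw : Continuous w) (a b : ℝ) :
    IntervalIntegrable (fun t => signedPow r (w t)) volume a b := by
  have hc : Continuous (fun t => |w t| ^ (r - 1)) :=
    hw.abs.rpow_const (fun _ => Or.inr (by linarith))
  refine (hc.intervalIntegrable a b).mono_fun
    ((measurable_signedPow hr).comp hw.measurable).aestronglyMeasurable ?_
  refine Eventually.of_forall fun t => ?_
  simp only [Real.norm_eq_abs]
  exact (abs_signedPow_le _).trans (le_abs_self _)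

/-- The fundamental theorem of calculus for `|w| ^ r`, where `w` is a small quadratic
perturbation of the identity. Since `w` vanishes at most once, it also holds for `r = 1`. -/
lemma integral_signedPow_mul_deriv (hr : 1 ≤ r) {h ε α β γ : ℝ} (hh : 0 ≤ h)
    (hpos : ∀ t ∈ Set.Icc (-h) h, 0 < 1 + ε * (2 * α * t + β)) :
    ∫ t in (-h)..h, r * signedPow r (t + ε * (α * t ^ 2 + β * t + γ)) *
        (1 + ε * (2 * α * t + β)) =
      |h + ε * (α * h ^ 2 + β * h + γ)| ^ r - |(-h) + ε * (α * h ^ 2 - β * h + γ)| ^ r := by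
  set w : ℝ → ℝ := fun t => t + ε * (α * t ^ 2 + β * t + γ) with hw
  have hwc : Continuous w := by fun_prop
  have hd : ∀ t, HasDerivAt w (1 + ε * (2 * α * t + β)) t := by
    intro t
    have h1 := (((hasDerivAt_id t).pow 2).const_mul α).add ((hasDerivAt_id t).const_mul β)
    have h2 := (hasDerivAt_id t).add ((h1.add_const γ).const_mul ε)
    refine h2.congr_deriv ?_
    simp only [id, Nat.cast_ofNat]
    ring
  have hmono : StrictMonoOn w (Set.Icc (-h) h) := by
    refine strictMonoOn_of_deriv_pos (convex_Icc _ _) hwc.continuousOn fun t ht => ?_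
    rw [(hd t).deriv]
    exact hpos t (interior_subset ht)
  have hcount : {t | t ∈ Set.Icc (-h) h ∧ w t = 0}.Countable := by
    refine Set.Subsingleton.countable fun s hs t ht => ?_
    exact hmono.injOn hs.1 ht.1 (hs.2.trans ht.2.symm)
  have := integral_eq_of_hasDerivAt_off_countable_of_le (fun t => |w t| ^ r)
    (fun t => r * signedPow r (w t) * (1 + ε * (2 * α * t + β))) (by linarith : -h ≤ h) hcount
    ((continuous_abs_rpow hr).comp hwc).continuousOn
    (fun t ht => by
      have h0 : w t ≠ 0 := fun h0 => ht.2 ⟨Set.Ioo_subset_Icc_self ht.1, h0⟩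
      exact (hasDerivAt_abs_rpow (r := r) h0).comp t (hd t))
    (((intervalIntegrable_signedPow_comp hr hwc _ _).const_mul r).mul_continuousOn
      (by fun_prop))
  rw [this]
  simp only [hw]
  congr 3
  ring

lemma integral_signedPow_eq_zero (hr : 1 ≤ r) {h : ℝ} (hh : 0 ≤ h) :
    ∫ t in (-h)..h, signedPow r t = 0 := by
  have := integral_signedPow_mul_deriv (r := r) hr (ε := 0) (α := 0) (β := 0) (γ := 0) hh
    (by simp)
  simp only [zero_mul, add_zero, mul_one, abs_neg, sub_self,
    intervalIntegral.integral_const_mul] at this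
  exact (mul_eq_zero.1 this).resolve_left (by linarith)

lemma integral_abs_rpow (hr : 1 ≤ r) {h : ℝ} (hh : 0 ≤ h) :
    ∫ t in (-h)..h, |t| ^ r = 2 * h ^ (r + 1) / (r + 1) := by
  have h1 : r + 1 ≠ 0 := by linarith
  have hc := continuous_abs_rpow hr
  have := integral_eq_of_hasDerivAt_off_countable_of_le (fun t : ℝ => (r + 1)⁻¹ * (t * |t| ^ r))
    (fun t => |t| ^ r) (by linarith : -h ≤ h) (Set.countable_singleton (0 : ℝ))
    (by fun_prop)
    (fun t ht => by
      have h0 : t ≠ 0 := ht.2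
      refine (((hasDerivAt_id t).mul (hasDerivAt_abs_rpow (r := r) h0)).const_mul
        (r + 1)⁻¹).congr_deriv ?_
      have := signedPow_mul_self (t := t) hr
      simp only [id, one_mul]
      rw [show t * (r * signedPow r t) = r * (signedPow r t * t) by ring, this]
      field_simp
      ring)
    (hc.intervalIntegrable _ _)
  rw [this, abs_neg, abs_of_nonneg hh, Real.rpow_add_one' hh h1]
  field_simp
  ring

lemma integral_signedPow_mul_affine (hr : 1 ≤ r) {h : ℝ} (hh : 0 ≤ h) (α β : ℝ) :
    ∫ t in (-h)..h, signedPow r t * (2 * α * t + β) = 4 * α * h ^ (r + 1) / (r + 1) := by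
  have e : ∀ t : ℝ, signedPow r t * (2 * α * t + β) = 2 * α * |t| ^ r + β * signedPow r t := by
    intro t; rw [← signedPow_mul_self hr]; ring
  simp_rw [e]
  rw [intervalIntegral.integral_add
    (((continuous_abs_rpow hr).intervalIntegrable _ _).const_mul (2 * α))
    (IntervalIntegrable.const_mul (f := signedPow r)
      (intervalIntegrable_signedPow_comp hr continuous_id _ _) β),
    intervalIntegral.integral_const_mul, intervalIntegral.integral_const_mul,
    integral_signedPow_eq_zero hr hh, integral_abs_rpow hr hh]
  ring

lemma integral_signedPow_slice (hr : 1 ≤ r) {h ε α β γ : ℝ} (hh : 0 ≤ h) (hε : 0 < ε)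
    (hpos : ∀ t ∈ Set.Icc (-h) h, 0 < 1 + ε * (2 * α * t + β)) :
    ε⁻¹ * ∫ t in (-h)..h, signedPow r (t + ε * (α * t ^ 2 + β * t + γ)) =
      r⁻¹ * (ε⁻¹ * (|h + ε * (α * h ^ 2 + β * h + γ)| ^ r -
        |(-h) + ε * (α * h ^ 2 - β * h + γ)| ^ r)) -
      ∫ t in (-h)..h, signedPow r (t + ε * (α * t ^ 2 + β * t + γ)) * (2 * α * t + β) := by
  have hi := intervalIntegrable_signedPow_comp hr
    (w := fun t => t + ε * (α * t ^ 2 + β * t + γ)) (by fun_prop) (-h) h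
  rw [← integral_signedPow_mul_deriv hr hh hpos]
  have e : ∀ t : ℝ, r * signedPow r (t + ε * (α * t ^ 2 + β * t + γ)) *
      (1 + ε * (2 * α * t + β)) = r * (signedPow r (t + ε * (α * t ^ 2 + β * t + γ)) +
        ε * (signedPow r (t + ε * (α * t ^ 2 + β * t + γ)) * (2 * α * t + β))) := by
    intro t; ring
  simp_rw [e]
  rw [intervalIntegral.integral_const_mul, intervalIntegral.integral_add hi
    ((hi.mul_continuousOn (by fun_prop)).const_mul ε), intervalIntegral.integral_const_mul]
  generalize ∫ t in (-h)..h, signedPow r (t + ε * (α * t ^ 2 + β * t + γ)) = I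
  generalize ∫ t in (-h)..h, signedPow r (t + ε * (α * t ^ 2 + β * t + γ)) * (2 * α * t + β) = I'
  have : r ≠ 0 := by linarith
  field_simp
  ring

lemma abs_quadratic_le {C α β γ t : ℝ} (hα : |α| ≤ C) (hβ : |β| ≤ C) (hγ : |γ| ≤ C)
    (ht : |t| ≤ 1) : |α * t ^ 2 + β * t + γ| ≤ 3 * C := by
  have h1 : |α * t ^ 2| ≤ C := by
    rw [abs_mul, abs_pow]
    calc |α| * |t| ^ 2 ≤ |α| * 1 := by gcongr; exact pow_le_one₀ (abs_nonneg _) ht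
      _ ≤ C := by linarith
  have h2 : |β * t| ≤ C := by
    rw [abs_mul]
    calc |β| * |t| ≤ |β| * 1 := by gcongr
      _ ≤ C := by linarith
  calc |α * t ^ 2 + β * t + γ| ≤ |α * t ^ 2| + |β * t| + |γ| := abs_add_three _ _ _
    _ ≤ 3 * C := by linarith

lemma abs_affine_le {C α β t : ℝ} (hα : |α| ≤ C) (hβ : |β| ≤ C)
    (ht : |t| ≤ 1) : |2 * α * t + β| ≤ 3 * C := by
  have h1 : |2 * α * t| ≤ 2 * C := by
    rw [abs_mul, abs_mul, abs_two]
    calc 2 * |α| * |t| ≤ 2 * |α| * 1 := by gcongr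
      _ ≤ 2 * C := by linarith
  calc |2 * α * t + β| ≤ |2 * α * t| + |β| := abs_add_le _ _
    _ ≤ 3 * C := by linarith

lemma abs_perturbation_le {C ε α β γ t : ℝ} (hε : 0 < ε) (hεC : ε * (3 * C) ≤ 1 / 2)
    (hα : |α| ≤ C) (hβ : |β| ≤ C) (hγ : |γ| ≤ C) (ht : |t| ≤ 1) :
    |t + ε * (α * t ^ 2 + β * t + γ)| ≤ 2 := by
  have := abs_quadratic_le hα hβ hγ ht
  calc |t + ε * (α * t ^ 2 + β * t + γ)| ≤ |t| + |ε * (α * t ^ 2 + β * t + γ)| := abs_add_le _ _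
    _ = |t| + ε * |α * t ^ 2 + β * t + γ| := by rw [abs_mul, abs_of_pos hε]
    _ ≤ 1 + ε * (3 * C) := by gcongr
    _ ≤ 2 := by linarith

lemma one_add_affine_pos {C ε α β t : ℝ} (hε : 0 < ε) (hεC : ε * (3 * C) ≤ 1 / 2)
    (hα : |α| ≤ C) (hβ : |β| ≤ C) (ht : |t| ≤ 1) : 0 < 1 + ε * (2 * α * t + β) := by
  have h1 := (abs_le.1 (abs_affine_le hα hβ ht)).1
  have h2 : ε * -(3 * C) ≤ ε * (2 * α * t + β) := by gcongr
  linarith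

lemma abs_integral_signedPow_slice_le (hr : 1 ≤ r) {C h ε α β γ : ℝ} (hh : 0 ≤ h) (hh1 : h ≤ 1)
    (hε : 0 < ε) (hεC : ε * (3 * C) ≤ 1 / 2) (hα : |α| ≤ C) (hβ : |β| ≤ C) (hγ : |γ| ≤ C) :
    |(ε⁻¹ * ∫ t in (-h)..h, signedPow r (t + ε * (α * t ^ 2 + β * t + γ)))| ≤
      12 * C * 2 ^ (r - 1) := by
  have habs : |h| ≤ 1 := by rwa [abs_of_nonneg hh]
  have hIcc : ∀ t ∈ Set.Icc (-h) h, |t| ≤ 1 := fun t ht => (abs_le.2 ht).trans hh1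
  rw [integral_signedPow_slice hr hh hε
    fun t ht => one_add_affine_pos hε hεC hα hβ (hIcc t ht)]
  have hC : 0 ≤ C := (abs_nonneg α).trans hα
  set D : ℝ := 2 ^ (r - 1) with hD
  have hD0 : 0 ≤ D := by positivity
  have h1 : |(|h + ε * (α * h ^ 2 + β * h + γ)| ^ r - |h| ^ r)| ≤ r * D * (ε * (3 * C)) := by
    refine (abs_abs_rpow_sub_le hr (abs_perturbation_le hε hεC hα hβ hγ habs)
      (habs.trans one_le_two)).trans ?_
    have : 0 ≤ r := by linarith
    rw [add_sub_cancel_left, abs_mul, abs_of_pos hε]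
    gcongr
    exact abs_quadratic_le hα hβ hγ habs
  have h2 : |(|(-h) + ε * (α * h ^ 2 - β * h + γ)| ^ r - |h| ^ r)| ≤ r * D * (ε * (3 * C)) := by
    have e : α * h ^ 2 - β * h + γ = α * (-h) ^ 2 + β * (-h) + γ := by ring
    rw [e]
    have hn : |(-h)| ≤ 1 := by rwa [abs_neg]
    have hlip := abs_abs_rpow_sub_le hr (abs_perturbation_le hε hεC hα hβ hγ hn)
      (hn.trans one_le_two)
    rw [abs_neg h] at hlip
    refine hlip.trans ?_
    have : 0 ≤ r := by linarith
    rw [add_sub_cancel_left, abs_mul, abs_of_pos hε]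
    gcongr
    exact abs_quadratic_le hα hβ hγ hn
  have h3 : |∫ t in (-h)..h, signedPow r (t + ε * (α * t ^ 2 + β * t + γ)) * (2 * α * t + β)| ≤
      D * (3 * C) * |h - -h| := by
    rw [← Real.norm_eq_abs]
    refine intervalIntegral.norm_integral_le_of_norm_le_const fun t ht => ?_
    rw [Set.uIoc_of_le (by linarith)] at ht
    have ht1 := hIcc t (Set.Ioc_subset_Icc_self ht)
    rw [norm_mul]
    exact mul_le_mul (abs_signedPow_le_of_abs_le hr
      (abs_perturbation_le hε hεC hα hβ hγ ht1)) (abs_affine_le hα hβ ht1) (norm_nonneg _) hD0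
  have h3' : D * (3 * C) * |h - -h| ≤ 6 * C * D := by
    rw [sub_neg_eq_add, abs_of_nonneg (by linarith)]
    have : D * (3 * C) * (h + h) ≤ D * (3 * C) * (1 + 1) := by gcongr
    linarith
  set X := |h + ε * (α * h ^ 2 + β * h + γ)| ^ r
  set Y := |(-h) + ε * (α * h ^ 2 - β * h + γ)| ^ r
  have h4 : |r⁻¹ * (ε⁻¹ * (X - Y))| ≤ 6 * C * D := by
    have hr0 : 0 < r := by linarith
    have : |X - Y| ≤ 2 * (r * D * (ε * (3 * C))) := by
      have := abs_sub_le X (|h| ^ r) Y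
      rw [abs_sub_comm (|h| ^ r) Y] at this
      linarith
    rw [abs_mul, abs_mul, abs_of_pos (inv_pos.2 hr0), abs_of_pos (inv_pos.2 hε)]
    calc r⁻¹ * (ε⁻¹ * |X - Y|) ≤ r⁻¹ * (ε⁻¹ * (2 * (r * D * (ε * (3 * C))))) := by gcongr
      _ = 6 * C * D := by field_simp; ring
  refine (abs_sub _ _).trans ?_
  linarith

/-- First-order expansion of the integral of `signedPow r` along a chord of the ball. -/
lemma tendsto_integral_signedPow_slice (hr : 1 ≤ r) {h : ℝ} (hh : 0 ≤ h) (hh1 : h ≤ 1)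
    (α β γ : ℝ) :
    Tendsto (fun ε : ℝ => ε⁻¹ * ∫ t in (-h)..h, signedPow r (t + ε * (α * t ^ 2 + β * t + γ)))
      (𝓝[>] 0) (𝓝 (2 * γ * signedPow r h + 2 * α * ((r - 1) / (r + 1)) * h ^ (r + 1))) := by
  obtain ⟨C, hα, hβ, hγ⟩ : ∃ C, |α| ≤ C ∧ |β| ≤ C ∧ |γ| ≤ C :=
    ⟨|α| + |β| + |γ|, by linarith [abs_nonneg β, abs_nonneg γ],
      by linarith [abs_nonneg α, abs_nonneg γ], by linarith [abs_nonneg β, abs_nonneg α]⟩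
  have hr0 : 0 < r := by linarith
  have hIcc : ∀ t ∈ Set.Icc (-h) h, |t| ≤ 1 := fun t ht => (abs_le.2 ht).trans hh1
  have hsmall : ∀ᶠ ε : ℝ in 𝓝[>] 0, 0 < ε ∧ ε * (3 * C) ≤ 1 / 2 := by
    have h1 : Tendsto (fun ε : ℝ => ε * (3 * C)) (𝓝[>] 0) (𝓝 0) := by
      have : Continuous fun ε : ℝ => ε * (3 * C) := by fun_prop
      simpa using (this.tendsto 0).mono_left nhdsWithin_le_nhds
    filter_upwards [self_mem_nhdsWithin, h1.eventually_le_const (by norm_num : (0 : ℝ) < 1 / 2)]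
      with ε h2 h3 using ⟨h2, h3⟩
  have hbdry : Tendsto (fun ε : ℝ => ε⁻¹ * (|h + ε * (α * h ^ 2 + β * h + γ)| ^ r -
        |(-h) + ε * (α * h ^ 2 - β * h + γ)| ^ r)) (𝓝[>] 0)
      (𝓝 (r * signedPow r h * (2 * α * h ^ 2 + 2 * γ))) := by
    rcases hh.eq_or_lt with rfl | hpos
    · simp
    · have hline : ∀ c g : ℝ, c ≠ 0 → HasDerivAt (fun ε : ℝ => |c + ε * g| ^ r)
          (r * signedPow r c * g) 0 := by
        intro c g hc
        have h1 : HasDerivAt (fun ε : ℝ => c + ε * g) g 0 := by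
          simpa using ((hasDerivAt_id (0 : ℝ)).mul_const g).const_add c
        have h2 : HasDerivAt (fun s : ℝ => |s| ^ r) (r * signedPow r c)
            ((fun ε : ℝ => c + ε * g) 0) := by
          simpa using hasDerivAt_abs_rpow (r := r) hc
        exact h2.comp 0 h1
      have hd := (hline h (α * h ^ 2 + β * h + γ) hpos.ne').sub
        (hline (-h) (α * h ^ 2 - β * h + γ) (neg_ne_zero.2 hpos.ne'))
      have ht := hd.tendsto_slope_zero_right
      simp only [Pi.sub_apply, zero_add, zero_mul, add_zero, abs_neg, sub_self, sub_zero,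
        smul_eq_mul, signedPow_neg] at ht
      convert ht using 2
      ring
  have hint : Tendsto (fun ε : ℝ => ∫ t in (-h)..h,
        signedPow r (t + ε * (α * t ^ 2 + β * t + γ)) * (2 * α * t + β)) (𝓝[>] 0)
      (𝓝 (∫ t in (-h)..h, signedPow r t * (2 * α * t + β))) := by
    refine intervalIntegral.tendsto_integral_filter_of_dominated_convergence
      (fun _ => 2 ^ (r - 1) * (3 * C)) ?_ ?_ intervalIntegrable_const ?_
    · refine Eventually.of_forall fun ε => Measurable.aestronglyMeasurable ?_
      exact ((measurable_signedPow hr).comp (by fun_prop)).mul (by fun_prop)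
    · filter_upwards [hsmall] with ε hε
      refine Eventually.of_forall fun t ht => ?_
      rw [Set.uIoc_of_le (by linarith)] at ht
      have ht1 := hIcc t (Set.Ioc_subset_Icc_self ht)
      rw [norm_mul]
      exact mul_le_mul (abs_signedPow_le_of_abs_le hr
        (abs_perturbation_le hε.1 hε.2 hα hβ hγ ht1)) (abs_affine_le hα hβ ht1) (norm_nonneg _)
        (by positivity)
    · have h0 : ∀ᵐ t : ℝ, t ≠ 0 := by
        simp [ae_iff]
      filter_upwards [h0] with t ht _
      refine Tendsto.mul_const _ ?_
      have h1 : Tendsto (fun ε : ℝ => t + ε * (α * t ^ 2 + β * t + γ)) (𝓝[>] 0) (𝓝 t) := by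
        have : Continuous fun ε : ℝ => t + ε * (α * t ^ 2 + β * t + γ) := by fun_prop
        simpa using (this.tendsto 0).mono_left nhdsWithin_le_nhds
      exact (continuousAt_signedPow ht).tendsto.comp h1
  rw [integral_signedPow_mul_affine hr hh] at hint
  have hlim := (hbdry.const_mul r⁻¹).sub hint
  have e : r⁻¹ * (r * signedPow r h * (2 * α * h ^ 2 + 2 * γ)) - 4 * α * h ^ (r + 1) / (r + 1) =
      2 * γ * signedPow r h + 2 * α * ((r - 1) / (r + 1)) * h ^ (r + 1) := by
    have h2 : signedPow r h * h ^ 2 = h ^ (r + 1) := by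
      rw [pow_two, ← mul_assoc, signedPow_mul_self hr, abs_of_nonneg hh,
        Real.rpow_add_one' hh (by linarith)]
    have h3 : r + 1 ≠ 0 := by linarith
    rw [← h2]
    field_simp
    ring
  rw [e] at hlim
  refine hlim.congr' ?_
  filter_upwards [hsmall] with ε hε
  exact (integral_signedPow_slice hr hh hε.1
    fun t ht => one_add_affine_pos hε.1 hε.2 hα hβ (hIcc t ht)).symm

end Slice

/-! ### Integrals over the equatorial ball -/

section HalfChord

variable {F : Type*} [NormedAddCommGroup F] {r : ℝ}

/-- Half of the length of the chord of the unit ball of `F × ℝ` over the point `y` of `F`. Since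
`Real.sqrt` vanishes on negative numbers, it is `0` when `y` lies outside the unit ball. -/
noncomputable def halfChord (y : F) : ℝ := √(1 - ‖y‖ ^ 2)

lemma halfChord_nonneg (y : F) : 0 ≤ halfChord y := Real.sqrt_nonneg _

lemma halfChord_le_one (y : F) : halfChord y ≤ 1 := by
  exact Real.sqrt_le_one.2 (by linarith [sq_nonneg ‖y‖])

lemma halfChord_eq_zero {y : F} (hy : 1 ≤ ‖y‖) : halfChord y = 0 :=
  Real.sqrt_eq_zero_of_nonpos (by nlinarith)

lemma halfChord_pos {y : F} (hy : ‖y‖ < 1) : 0 < halfChord y :=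
  Real.sqrt_pos.2 (by nlinarith [norm_nonneg y])

lemma continuous_halfChord : Continuous (halfChord : F → ℝ) := by
  unfold halfChord; fun_prop

lemma halfChord_rpow_eq (hr : 1 ≤ r) (y : F) :
    halfChord y ^ (r + 1) = |1 - (min ‖y‖ 1) ^ 2| ^ ((r + 1) / 2) := by
  rcases le_total ‖y‖ 1 with h | h
  · have h0 : 0 ≤ 1 - ‖y‖ ^ 2 := by nlinarith [norm_nonneg y]
    rw [min_eq_left h, abs_of_nonneg h0, halfChord, Real.sqrt_eq_rpow, ← Real.rpow_mul h0]
    congr 1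
    ring
  · rw [min_eq_right h, halfChord_eq_zero h]
    simp [Real.zero_rpow (by linarith : r + 1 ≠ 0), Real.zero_rpow (by linarith : (r + 1) / 2 ≠ 0)]

/-- `halfChord y ^ (r + 1)` is the positive part of `1 - ‖y‖ ^ 2` to a power that is at least
`1`, so it is Lipschitz up to the unit sphere. -/
lemma exists_lipschitzWith_halfChord_rpow (hr : 1 ≤ r) :
    ∃ C, LipschitzWith C (fun y : F => halfChord y ^ (r + 1)) := by
  refine ⟨Real.toNNReal ((r + 1) / 2 * 2), LipschitzWith.of_dist_le_mul fun y z => ?_⟩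
  rw [Real.coe_toNNReal _ (by linarith), Real.dist_eq, halfChord_rpow_eq hr, halfChord_rpow_eq hr]
  set a := min ‖y‖ 1
  set b := min ‖z‖ 1
  have ha0 : 0 ≤ a := le_min (norm_nonneg _) zero_le_one
  have hb0 : 0 ≤ b := le_min (norm_nonneg _) zero_le_one
  have ha1 : a ≤ 1 := min_le_right _ _
  have hb1 : b ≤ 1 := min_le_right _ _
  have hab : |a - b| ≤ dist y z := by
    have h1 : |a - b| ≤ max |‖y‖ - ‖z‖| |(1 : ℝ) - 1| := abs_min_sub_min_le_max _ _ _ _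
    rw [sub_self, abs_zero, max_eq_left (abs_nonneg _)] at h1
    rw [dist_eq_norm]
    exact h1.trans (abs_norm_sub_norm_le y z)
  have hA : |1 - a ^ 2| ≤ 1 := abs_le.2 ⟨by nlinarith, by nlinarith⟩
  have hB : |1 - b ^ 2| ≤ 1 := abs_le.2 ⟨by nlinarith, by nlinarith⟩
  refine (abs_abs_rpow_sub_le (r := (r + 1) / 2) (by linarith) hA hB).trans ?_
  rw [Real.one_rpow, mul_one, mul_assoc]
  have hr0 : 0 ≤ (r + 1) / 2 := by linarith
  gcongr
  have e : (1 - a ^ 2) - (1 - b ^ 2) = -((a + b) * (a - b)) := by ring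
  rw [e, abs_neg, abs_mul, abs_of_nonneg (by linarith : 0 ≤ a + b)]
  gcongr
  linarith

lemma hasCompactSupport_halfChord_rpow [ProperSpace F] (hr : 1 ≤ r) :
    HasCompactSupport (fun y : F => halfChord y ^ (r + 1)) := by
  refine HasCompactSupport.intro (isCompact_closedBall (0 : F) 1) fun y hy => ?_
  rw [mem_closedBall_zero_iff, not_le] at hy
  rw [halfChord_eq_zero hy.le, Real.zero_rpow (by linarith)]

lemma continuous_halfChord_rpow (hr : 1 ≤ r) :
    Continuous (fun y : F => halfChord y ^ (r + 1)) :=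
  continuous_halfChord.rpow_const fun _ => Or.inr (by linarith)

lemma measurable_signedPow_halfChord [MeasurableSpace F] [BorelSpace F] (hr : 1 ≤ r) :
    Measurable fun y : F => signedPow r (halfChord y) :=
  (measurable_signedPow hr).comp continuous_halfChord.measurable

variable [InnerProductSpace ℝ F]

lemma lineDeriv_halfChord_rpow (hr : 1 ≤ r) {y : F} (hy : ‖y‖ ≠ 1) (v : F) :
    lineDeriv ℝ (fun y : F => halfChord y ^ (r + 1)) y (-v) =
      (r + 1) * signedPow r (halfChord y) * inner ℝ v y := by
  rcases lt_or_gt_of_ne hy with h | h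
  · have hbase : HasFDerivAt (fun y : F => 1 - ‖y‖ ^ 2) (-(2 • innerSL ℝ y)) y := by
      simpa using (hasStrictFDerivAt_norm_sq y).hasFDerivAt.const_sub 1
    have h0 : 0 < 1 - ‖y‖ ^ 2 := by nlinarith [norm_nonneg y]
    have hd := (hbase.rpow_const (p := (r + 1) / 2) (Or.inl h0.ne')).hasLineDerivAt (-v)
    have hev : (fun y : F => halfChord y ^ (r + 1)) =ᶠ[𝓝 y]
        fun y => (1 - ‖y‖ ^ 2) ^ ((r + 1) / 2) := by
      have hc : Continuous fun y : F => 1 - ‖y‖ ^ 2 := by fun_prop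
      filter_upwards [hc.continuousAt.eventually_const_le h0] with z hz
      rw [halfChord, Real.sqrt_eq_rpow, ← Real.rpow_mul hz]
      congr 1
      ring
    rw [hev.lineDeriv_eq, hd.lineDeriv, signedPow_of_pos (halfChord_pos h), halfChord,
      Real.sqrt_eq_rpow, ← Real.rpow_mul h0.le]
    have e : (1 : ℝ) / 2 * (r - 1) = (r + 1) / 2 - 1 := by ring
    rw [e, real_inner_comm]
    simp
    ring
  · have hev : (fun y : F => halfChord y ^ (r + 1)) =ᶠ[𝓝 y] fun _ => 0 := by
      filter_upwards [continuous_norm.continuousAt.eventually_const_le h] with z hz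
      rw [halfChord_eq_zero hz, Real.zero_rpow (by linarith)]
    rw [hev.lineDeriv_eq, halfChord_eq_zero h.le]
    simp [lineDeriv]

variable [FiniteDimensional ℝ F] [MeasurableSpace F] [BorelSpace F]

/-- Integration by parts on the unit ball: the boundary term vanishes since
`halfChord y ^ (r + 1)` does so on the unit sphere. -/
lemma integral_signedPow_halfChord_mul_inner (hr : 1 ≤ r) (v w : F) :
    ∫ y : F, signedPow r (halfChord y) * (inner ℝ v y * inner ℝ w y) =
      inner ℝ v w * ((∫ y : F, halfChord y ^ (r + 1)) / (r + 1)) := by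
  obtain ⟨C, hC⟩ := exists_lipschitzWith_halfChord_rpow (F := F) hr
  have hw : LipschitzWith ‖innerSL ℝ w‖₊ (fun y : F => inner ℝ w y) := (innerSL ℝ w).lipschitz
  have hparts := hw.integral_lineDeriv_mul_eq (μ := volume) hC
    (hasCompactSupport_halfChord_rpow hr) v
  have hl : ∀ y : F, lineDeriv ℝ (fun y : F => inner ℝ w y) y v = inner ℝ w v := fun y =>
    ((innerSL ℝ w).hasFDerivAt.hasLineDerivAt v).lineDeriv
  simp_rw [hl] at hparts
  have hsphere : ∀ᵐ y : F, ‖y‖ ≠ 1 := by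
    have := Measure.addHaar_sphere_of_ne_zero (volume : Measure F) 0 one_ne_zero
    rw [ae_iff]
    convert this using 2
    ext y; simp
  have hrhs : ∫ y : F, lineDeriv ℝ (fun y : F => halfChord y ^ (r + 1)) y (-v) * inner ℝ w y =
      ∫ y : F, (r + 1) * (signedPow r (halfChord y) * (inner ℝ v y * inner ℝ w y)) := by
    refine integral_congr_ae ?_
    filter_upwards [hsphere] with y hy
    rw [lineDeriv_halfChord_rpow hr hy]
    ring
  rw [hrhs, integral_const_mul, integral_const_mul, real_inner_comm] at hparts
  have : r + 1 ≠ 0 := by linarith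
  rw [← mul_div_assoc, eq_div_iff this, hparts]
  ring

lemma integrable_signedPow_halfChord_mul (hr : 1 ≤ r) {f : F → ℝ} (hf : Continuous f) :
    Integrable fun y : F => signedPow r (halfChord y) * f y := by
  have hi : IntegrableOn f (Metric.closedBall 0 1) :=
    hf.continuousOn.integrableOn_compact (isCompact_closedBall _ _)
  have h1 : IntegrableOn (fun y : F => signedPow r (halfChord y) * f y)
      (Metric.closedBall 0 1) := by
    refine hi.bdd_mul (c := 1) (measurable_signedPow_halfChord hr).aestronglyMeasurable ?_
    refine Eventually.of_forall fun y => ?_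
    have := abs_signedPow_le_of_abs_le (R := 1) hr (t := halfChord y)
      (by rw [abs_of_nonneg (halfChord_nonneg y)]; exact halfChord_le_one y)
    simpa using this
  refine (integrableOn_iff_integrable_of_support_subset fun y hy => ?_).1 h1
  by_contra h
  rw [mem_closedBall_zero_iff, not_le] at h
  exact hy (by simp [halfChord_eq_zero h.le])

lemma integrable_halfChord_rpow (hr : 1 ≤ r) :
    Integrable fun y : F => halfChord y ^ (r + 1) :=
  (continuous_halfChord_rpow hr).integrable_of_hasCompactSupport
    (hasCompactSupport_halfChord_rpow hr)

lemma integral_signedPow_halfChord_pos (hr : 1 ≤ r) :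
    0 < ∫ y : F, signedPow r (halfChord y) := by
  have hi : Integrable fun y : F => signedPow r (halfChord y) := by
    simpa using integrable_signedPow_halfChord_mul (F := F) hr (continuous_const (y := (1 : ℝ)))
  rw [integral_pos_iff_support_of_nonneg (fun y => signedPow_nonneg (halfChord_nonneg y)) hi]
  refine (Metric.measure_ball_pos volume (0 : F) one_pos).trans_le (measure_mono fun y hy => ?_)
  rw [mem_ball_zero_iff] at hy
  exact (signedPow_pos (halfChord_pos hy)).ne'

lemma integral_halfChord_rpow_pos (hr : 1 ≤ r) :
    0 < ∫ y : F, halfChord y ^ (r + 1) := by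
  rw [integral_pos_iff_support_of_nonneg
    (fun y => Real.rpow_nonneg (halfChord_nonneg y) _) (integrable_halfChord_rpow hr)]
  refine (Metric.measure_ball_pos volume (0 : F) one_pos).trans_le (measure_mono fun y hy => ?_)
  rw [mem_ball_zero_iff] at hy
  exact (Real.rpow_pos_of_pos (halfChord_pos hy) _).ne'

end HalfChord

/-! ### Integration over the chords of the ball -/

section Fubini

variable {F : Type*} [NormedAddCommGroup F] {r : ℝ}

lemma integral_indicator_productBall (f : F × ℝ → ℝ) (y : F) :
    ∫ t : ℝ, {z : F × ℝ | z.2 ^ 2 + ‖z.1‖ ^ 2 ≤ 1}.indicator f (y, t) =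
      ∫ t in (-halfChord y)..(halfChord y), f (y, t) := by
  have h0 := halfChord_nonneg y
  rcases le_or_gt ‖y‖ 1 with h | h
  · have hsq : halfChord y ^ 2 = 1 - ‖y‖ ^ 2 :=
      Real.sq_sqrt (by nlinarith [norm_nonneg y])
    have e : (fun t : ℝ => {z : F × ℝ | z.2 ^ 2 + ‖z.1‖ ^ 2 ≤ 1}.indicator f (y, t)) =
        (Set.Icc (-halfChord y) (halfChord y)).indicator fun t => f (y, t) := by
      ext t
      have hiff : t ^ 2 + ‖y‖ ^ 2 ≤ 1 ↔ t ∈ Set.Icc (-halfChord y) (halfChord y) := by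
        rw [Set.mem_Icc, ← abs_le, ← abs_of_nonneg h0, ← sq_le_sq, hsq]
        constructor <;> intro <;> linarith
      by_cases ht : t ^ 2 + ‖y‖ ^ 2 ≤ 1
      · rw [Set.indicator_of_mem (hiff.1 ht)]
        exact Set.indicator_of_mem (s := {z : F × ℝ | z.2 ^ 2 + ‖z.1‖ ^ 2 ≤ 1}) ht f
      · rw [Set.indicator_of_notMem (fun h => ht (hiff.2 h))]
        exact Set.indicator_of_notMem (s := {z : F × ℝ | z.2 ^ 2 + ‖z.1‖ ^ 2 ≤ 1}) ht f
    rw [e, integral_indicator measurableSet_Icc, integral_Icc_eq_integral_Ioc,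
      intervalIntegral.integral_of_le (by linarith)]
  · rw [halfChord_eq_zero h.le, neg_zero, intervalIntegral.integral_same]
    have e : (fun t : ℝ => {z : F × ℝ | z.2 ^ 2 + ‖z.1‖ ^ 2 ≤ 1}.indicator f (y, t)) =
        fun _ => 0 := by
      ext t
      refine Set.indicator_of_notMem (fun ht => ?_) f
      have : t ^ 2 + ‖y‖ ^ 2 ≤ 1 := ht
      nlinarith [sq_nonneg t]
    rw [e, integral_zero]

lemma integrableOn_signedPow_comp {X : Type*} [TopologicalSpace X] [MeasurableSpace X]
    [OpensMeasurableSpace X] {μ : Measure X} [IsFiniteMeasureOnCompacts μ] (hr : 1 ≤ r)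
    {f : X → ℝ} {s : Set X} (hs : IsCompact s) (hsm : MeasurableSet s) (hf : ContinuousOn f s) :
    IntegrableOn (fun x => signedPow r (f x)) s μ := by
  obtain ⟨C, hC⟩ := hs.exists_bound_of_continuousOn hf
  have hfin : μ s ≠ ∞ := hs.measure_lt_top.ne
  refine IntegrableOn.of_bound hs.measure_lt_top
    ((measurable_signedPow hr).comp_aemeasurable (hf.aemeasurable hsm)).aestronglyMeasurable
    (C ^ (r - 1)) ?_
  filter_upwards [ae_restrict_mem hsm] with x hx
  exact abs_signedPow_le_of_abs_le hr (hC x hx)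

variable [InnerProductSpace ℝ F] [FiniteDimensional ℝ F]

lemma isCompact_productBall :
    IsCompact {z : F × ℝ | z.2 ^ 2 + ‖z.1‖ ^ 2 ≤ 1} := by
  refine Metric.isCompact_of_isClosed_isBounded (isClosed_le (by fun_prop) continuous_const) ?_
  refine (Metric.isBounded_closedBall (x := (0 : F × ℝ)) (r := 1)).subset fun z hz => ?_
  have hz' : z.2 ^ 2 + ‖z.1‖ ^ 2 ≤ 1 := hz
  rw [mem_closedBall_zero_iff, Prod.norm_def, max_le_iff, Real.norm_eq_abs]
  exact ⟨by nlinarith [sq_nonneg z.2, norm_nonneg z.1], abs_le_one_iff_mul_self_le_one.2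
    (by nlinarith [sq_nonneg ‖z.1‖])⟩

variable [MeasurableSpace F] [BorelSpace F]

/-- First-order expansion of the integral of `signedPow r` over the unit ball of `F × ℝ`, obtained
by integrating over the chords parallel to the second factor. -/
lemma tendsto_integral_signedPow_productBall (hr : 1 ≤ r) (α : ℝ) {β γ : F → ℝ}
    (hβ : Continuous β) (hγ : Continuous γ) :
    Tendsto (fun ε : ℝ => ε⁻¹ * ∫ z in {z : F × ℝ | z.2 ^ 2 + ‖z.1‖ ^ 2 ≤ 1},
        signedPow r (z.2 + ε * (α * z.2 ^ 2 + β z.1 * z.2 + γ z.1)))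
      (𝓝[>] 0) (𝓝 (∫ y : F, (2 * γ y * signedPow r (halfChord y) +
        2 * α * ((r - 1) / (r + 1)) * halfChord y ^ (r + 1)))) := by
  set S : Set (F × ℝ) := {z : F × ℝ | z.2 ^ 2 + ‖z.1‖ ^ 2 ≤ 1} with hS
  have hSm : MeasurableSet S := isCompact_productBall.isClosed.measurableSet
  have hint : ∀ ε : ℝ, Integrable (S.indicator fun z : F × ℝ =>
      signedPow r (z.2 + ε * (α * z.2 ^ 2 + β z.1 * z.2 + γ z.1)))
      ((volume : Measure F).prod (volume : Measure ℝ)) := by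
    intro ε
    rw [integrable_indicator_iff hSm]
    exact integrableOn_signedPow_comp hr isCompact_productBall hSm
      (Continuous.continuousOn (by fun_prop))
  have hfub : ∀ ε : ℝ, ∫ z in S,
      signedPow r (z.2 + ε * (α * z.2 ^ 2 + β z.1 * z.2 + γ z.1)) =
      ∫ y : F, ∫ t in (-halfChord y)..(halfChord y),
        signedPow r (t + ε * (α * t ^ 2 + β y * t + γ y)) := by
    intro ε
    rw [← integral_indicator hSm, Measure.volume_eq_prod, integral_prod _ (hint ε)]
    simp_rw [hS, integral_indicator_productBall]
  have hmeas : ∀ ε : ℝ, AEStronglyMeasurable (fun y : F =>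
      ε⁻¹ * ∫ t in (-halfChord y)..(halfChord y),
        signedPow r (t + ε * (α * t ^ 2 + β y * t + γ y))) volume := by
    intro ε
    have := (hint ε).integral_prod_left.aestronglyMeasurable.const_mul ε⁻¹
    simpa only [hS, integral_indicator_productBall] using this
  simp_rw [hfub, ← integral_const_mul]
  obtain ⟨C₁, hC₁⟩ := (isCompact_closedBall (0 : F) 1).exists_bound_of_continuousOn
    hβ.continuousOn
  obtain ⟨C₂, hC₂⟩ := (isCompact_closedBall (0 : F) 1).exists_bound_of_continuousOn
    hγ.continuousOn
  set C := |α| + |C₁| + |C₂| with hC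
  have hsmall : ∀ᶠ ε : ℝ in 𝓝[>] 0, 0 < ε ∧ ε * (3 * C) ≤ 1 / 2 := by
    have h1 : Tendsto (fun ε : ℝ => ε * (3 * C)) (𝓝[>] 0) (𝓝 0) := by
      have : Continuous fun ε : ℝ => ε * (3 * C) := by fun_prop
      simpa using (this.tendsto 0).mono_left nhdsWithin_le_nhds
    filter_upwards [self_mem_nhdsWithin, h1.eventually_le_const (by norm_num : (0 : ℝ) < 1 / 2)]
      with ε h2 h3 using ⟨h2, h3⟩
  refine tendsto_integral_filter_of_dominated_convergence
    ((Metric.closedBall (0 : F) 1).indicator fun _ => 12 * C * 2 ^ (r - 1))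
    (Eventually.of_forall hmeas) ?_ ?_ ?_
  · filter_upwards [hsmall] with ε hε
    refine Eventually.of_forall fun y => ?_
    by_cases hy : y ∈ Metric.closedBall (0 : F) 1
    · rw [Set.indicator_of_mem hy]
      refine abs_integral_signedPow_slice_le hr (halfChord_nonneg y) (halfChord_le_one y) hε.1
        hε.2 ?_ ?_ ?_
      · linarith [abs_nonneg C₁, abs_nonneg C₂]
      · have := (hC₁ y hy).trans (le_abs_self C₁)
        rw [Real.norm_eq_abs] at this
        linarith [abs_nonneg α, abs_nonneg C₂]
      · have := (hC₂ y hy).trans (le_abs_self C₂)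
        rw [Real.norm_eq_abs] at this
        linarith [abs_nonneg α, abs_nonneg C₁]
    · rw [Set.indicator_of_notMem hy]
      rw [mem_closedBall_zero_iff, not_le] at hy
      simp [halfChord_eq_zero hy.le]
  · rw [integrable_indicator_iff measurableSet_closedBall]
    exact integrableOn_const (isCompact_closedBall _ _).measure_lt_top.ne
  · exact Eventually.of_forall fun y => tendsto_integral_signedPow_slice hr (halfChord_nonneg y)
      (halfChord_le_one y) α (β y) (γ y)

end Fubini

/-! ### Orthonormal coordinates -/

section Coordinates

variable {n : ℕ} {r : ℝ}

/-- The isometric coordinates `(y, t) ↦ t • b 0 + ∑ j, y j • b (j + 1)` given by an orthonormal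
basis `b`. -/
noncomputable def basisCoord (b : OrthonormalBasis (Fin (n + 1)) ℝ (EuclideanSpace ℝ (Fin (n + 1))))
    (z : EuclideanSpace ℝ (Fin n) × ℝ) : EuclideanSpace ℝ (Fin (n + 1)) :=
  b.repr.symm (WithLp.toLp 2 (Fin.cons z.2 z.1 : Fin (n + 1) → ℝ))

variable (b : OrthonormalBasis (Fin (n + 1)) ℝ (EuclideanSpace ℝ (Fin (n + 1))))

lemma basisCoord_eq (z : EuclideanSpace ℝ (Fin n) × ℝ) :
    basisCoord b z = z.2 • b 0 + ∑ j : Fin n, z.1 j • b j.succ := by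
  rw [basisCoord, ← b.sum_repr_symm, Fin.sum_univ_succ]
  simp

lemma norm_basisCoord_sq (z : EuclideanSpace ℝ (Fin n) × ℝ) :
    ‖basisCoord b z‖ ^ 2 = z.2 ^ 2 + ‖z.1‖ ^ 2 := by
  rw [basisCoord, LinearIsometryEquiv.norm_map, EuclideanSpace.norm_sq_eq,
    EuclideanSpace.norm_sq_eq, Fin.sum_univ_succ]
  simp

lemma measurePreserving_basisCoord : MeasurePreserving (basisCoord b) := by
  have h1 := ((MeasurePreserving.id (volume : Measure ℝ)).prod
    (PiLp.volume_preserving_ofLp (Fin n))).comp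
      (Measure.measurePreserving_swap (μ := (volume : Measure (EuclideanSpace ℝ (Fin n))))
        (ν := (volume : Measure ℝ)))
  have h2 := (volume_preserving_piFinSuccAbove (fun _ : Fin (n + 1) => ℝ) 0).symm
  have h3 := b.measurePreserving_repr_symm.comp
    ((PiLp.volume_preserving_toLp (Fin (n + 1))).comp (h2.comp h1))
  have e : basisCoord b = ⇑b.repr.symm ∘ WithLp.toLp 2 ∘
      ⇑(MeasurableEquiv.piFinSuccAbove (fun _ : Fin (n + 1) => ℝ) 0).symm ∘
        Prod.map id WithLp.ofLp ∘ Prod.swap := by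
    funext z
    simp [basisCoord, MeasurableEquiv.piFinSuccAbove_symm_apply, Fin.insertNthEquiv]
  rw [e]
  exact h3

lemma basisCoord_preimage_closedBall :
    basisCoord b ⁻¹' Metric.closedBall 0 1 = {z | z.2 ^ 2 + ‖z.1‖ ^ 2 ≤ 1} := by
  ext z
  rw [Set.mem_preimage, mem_closedBall_zero_iff, Set.mem_ofPred_eq, ← norm_basisCoord_sq b,
    sq_le_one_iff₀ (norm_nonneg _)]

lemma inner_basisCoord (z : EuclideanSpace ℝ (Fin n) × ℝ) :
    inner ℝ (b 0) (basisCoord b z) = z.2 := by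
  rw [← b.repr_apply_apply, basisCoord, LinearIsometryEquiv.apply_symm_apply]
  simp

/-- The mixed second moments over the ball vanish, and the diagonal ones coincide. -/
lemma integral_signedPow_halfChord_mul_quadratic (hr : 1 ≤ r) (B : Fin n → Fin n → ℝ) :
    ∫ y : EuclideanSpace ℝ (Fin n), signedPow r (halfChord y) * (∑ i, ∑ j, B i j * (y i * y j)) =
      (∑ i, B i i) * ((∫ y : EuclideanSpace ℝ (Fin n), halfChord y ^ (r + 1)) / (r + 1)) := by
  have hco : ∀ (i : Fin n) (y : EuclideanSpace ℝ (Fin n)),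
      inner ℝ (EuclideanSpace.single i (1 : ℝ)) y = y i := by
    intro i y; simp [EuclideanSpace.inner_single_left]
  have hmom : ∀ i j : Fin n, ∫ y : EuclideanSpace ℝ (Fin n),
      signedPow r (halfChord y) * (y i * y j) =
      if i = j then (∫ y : EuclideanSpace ℝ (Fin n), halfChord y ^ (r + 1)) / (r + 1) else 0 := by
    intro i j
    have := integral_signedPow_halfChord_mul_inner hr (EuclideanSpace.single i (1 : ℝ))
      (EuclideanSpace.single j (1 : ℝ))
    simp_rw [hco] at this
    rw [this]
    by_cases h : i = j
    · subst h; simp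
    · simp [h]
  have hi : ∀ i j : Fin n, Integrable fun y : EuclideanSpace ℝ (Fin n) =>
      B i j * (signedPow r (halfChord y) * (y i * y j)) := fun i j =>
    (integrable_signedPow_halfChord_mul hr (by fun_prop)).const_mul _
  have e : ∀ y : EuclideanSpace ℝ (Fin n),
      signedPow r (halfChord y) * (∑ i, ∑ j, B i j * (y i * y j)) =
      ∑ i, ∑ j, B i j * (signedPow r (halfChord y) * (y i * y j)) := by
    intro y
    rw [Finset.mul_sum]
    refine Finset.sum_congr rfl fun i _ => ?_
    rw [Finset.mul_sum]
    exact Finset.sum_congr rfl fun j _ => by ring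
  simp_rw [e]
  rw [integral_finsetSum _ fun i _ => integrable_finsetSum _ fun j _ => hi i j, Finset.sum_mul]
  refine Finset.sum_congr rfl fun i _ => ?_
  rw [integral_finsetSum _ fun j _ => hi i j]
  simp_rw [integral_const_mul, hmom]
  simp

/-- First-order expansion of the integral of `signedPow r` over the unit ball, for a perturbation
of a linear coordinate by a quadratic form and a constant: the quadratic form `A` enters only
through `tr A + (r - 2) * ⟪A e, e⟫`. -/
lemma tendsto_integral_signedPow_basis (hr : 1 ≤ r)
    (A : EuclideanSpace ℝ (Fin (n + 1)) →L[ℝ] EuclideanSpace ℝ (Fin (n + 1))) (a : ℝ) :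
    Tendsto (fun ε : ℝ => ε⁻¹ * ∫ z in Metric.closedBall (0 : EuclideanSpace ℝ (Fin (n + 1))) 1,
        signedPow r (inner ℝ (b 0) z + ε * (2⁻¹ * inner ℝ (A z) z - a))) (𝓝[>] 0)
      (𝓝 ((∫ y : EuclideanSpace ℝ (Fin n), halfChord y ^ (r + 1)) / (r + 1) *
          (∑ i, inner ℝ (A (b i)) (b i) + (r - 2) * inner ℝ (A (b 0)) (b 0)) -
        a * (2 * ∫ y : EuclideanSpace ℝ (Fin n), signedPow r (halfChord y)))) := by
  set J : EuclideanSpace ℝ (Fin n) → EuclideanSpace ℝ (Fin (n + 1)) :=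
    fun y => ∑ j : Fin n, y j • b j.succ with hJ
  have hJc : Continuous J := by fun_prop
  set α : ℝ := 2⁻¹ * inner ℝ (A (b 0)) (b 0) with hα
  set β : EuclideanSpace ℝ (Fin n) → ℝ := fun y =>
    2⁻¹ * (inner ℝ (A (b 0)) (J y) + inner ℝ (A (J y)) (b 0)) with hβ
  set γ : EuclideanSpace ℝ (Fin n) → ℝ := fun y => 2⁻¹ * inner ℝ (A (J y)) (J y) - a with hγ
  have hint : ∀ ε : ℝ, ∫ z in Metric.closedBall (0 : EuclideanSpace ℝ (Fin (n + 1))) 1,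
        signedPow r (inner ℝ (b 0) z + ε * (2⁻¹ * inner ℝ (A z) z - a)) =
      ∫ z in {z : EuclideanSpace ℝ (Fin n) × ℝ | z.2 ^ 2 + ‖z.1‖ ^ 2 ≤ 1},
        signedPow r (z.2 + ε * (α * z.2 ^ 2 + β z.1 * z.2 + γ z.1)) := by
    intro ε
    have hP := measurePreserving_basisCoord b
    have hm : Measurable fun z : EuclideanSpace ℝ (Fin (n + 1)) =>
        signedPow r (inner ℝ (b 0) z + ε * (2⁻¹ * inner ℝ (A z) z - a)) :=
      (measurable_signedPow hr).comp (by fun_prop)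
    conv_lhs => rw [← hP.map_eq]
    rw [setIntegral_map measurableSet_closedBall hm.aestronglyMeasurable hP.measurable.aemeasurable,
      basisCoord_preimage_closedBall]
    refine integral_congr_ae (Eventually.of_forall fun z => ?_)
    simp only
    rw [inner_basisCoord, basisCoord_eq]
    congr 3
    change 2⁻¹ * inner ℝ (A (z.2 • b 0 + J z.1)) (z.2 • b 0 + J z.1) - a = _
    simp only [hα, hβ, hγ, map_add, map_smul, inner_add_left, inner_add_right, inner_smul_left,
      inner_smul_right, conj_trivial]
    ring
  simp_rw [hint]
  convert tendsto_integral_signedPow_productBall hr α (β := β) (γ := γ) (by fun_prop)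
    (by fun_prop) using 2
  have hquad : ∀ y, inner ℝ (A (J y)) (J y) =
      ∑ i, ∑ j, inner ℝ (A (b i.succ)) (b j.succ) * (y i * y j) := by
    intro y
    simp only [hJ, map_sum, map_smul, sum_inner, inner_sum, inner_smul_left, inner_smul_right,
      conj_trivial, Finset.mul_sum]
    rw [Finset.sum_comm]
    exact Finset.sum_congr rfl fun i _ => Finset.sum_congr rfl fun j _ => by ring
  have hmom := integral_signedPow_halfChord_mul_quadratic hr
    fun i j => inner ℝ (A (b i.succ)) (b j.succ)
  simp_rw [← hquad] at hmom
  have e : ∀ y : EuclideanSpace ℝ (Fin n), 2 * γ y * signedPow r (halfChord y) +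
        2 * α * ((r - 1) / (r + 1)) * halfChord y ^ (r + 1) =
      signedPow r (halfChord y) * inner ℝ (A (J y)) (J y) +
        ((-(2 * a)) * signedPow r (halfChord y) +
        2 * α * ((r - 1) / (r + 1)) * halfChord y ^ (r + 1)) := by
    intro y; simp only [hγ]; ring
  simp_rw [e]
  have hK : Integrable fun y : EuclideanSpace ℝ (Fin n) => signedPow r (halfChord y) := by
    simpa using integrable_signedPow_halfChord_mul (F := EuclideanSpace ℝ (Fin n)) hr
      (continuous_const (y := (1 : ℝ)))
  have hI₁ : Integrable fun y : EuclideanSpace ℝ (Fin n) =>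
      -(2 * a) * signedPow r (halfChord y) := hK.const_mul _
  have hI₂ : Integrable fun y : EuclideanSpace ℝ (Fin n) =>
      2 * α * ((r - 1) / (r + 1)) * halfChord y ^ (r + 1) :=
    (integrable_halfChord_rpow hr).const_mul _
  have hI₃ : Integrable fun y : EuclideanSpace ℝ (Fin n) =>
      -(2 * a) * signedPow r (halfChord y) +
        2 * α * ((r - 1) / (r + 1)) * halfChord y ^ (r + 1) := hI₁.add hI₂
  rw [integral_add (integrable_signedPow_halfChord_mul hr (by fun_prop)) hI₃,
    integral_add hI₁ hI₂,
    integral_const_mul, integral_const_mul, hmom, Fin.sum_univ_succ, hα]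
  have : r + 1 ≠ 0 := by linarith
  field_simp
  ring

/-- The expansion `tendsto_integral_signedPow_basis` for a unit vector `e`, completed to an
orthonormal basis. The constants `M` and `K` do not depend on `A` and `a`. -/
lemma exists_tendsto_integral_signedPow_ball {N : ℕ} (hr : 1 ≤ r) {e : EuclideanSpace ℝ (Fin N)}
    (he : ‖e‖ = 1) :
    ∃ M K : ℝ, 0 < M ∧ 0 < K ∧
      ∀ (A : EuclideanSpace ℝ (Fin N) →L[ℝ] EuclideanSpace ℝ (Fin N)) (a : ℝ),
      Tendsto (fun ε : ℝ => ε⁻¹ * ∫ z in Metric.closedBall (0 : EuclideanSpace ℝ (Fin N)) 1,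
          signedPow r (inner ℝ e z + ε * (2⁻¹ * inner ℝ (A z) z - a))) (𝓝[>] 0)
        (𝓝 (M * (∑ i, A (EuclideanSpace.single i 1) i + (r - 2) * inner ℝ (A e) e) - a * K)) := by
  cases N with
  | zero =>
    rw [Subsingleton.elim e 0, norm_zero] at he
    exact absurd he zero_ne_one
  | succ n =>
    obtain ⟨b, hb⟩ := Orthonormal.exists_orthonormalBasis_extension_of_card_eq (𝕜 := ℝ)
      (E := EuclideanSpace ℝ (Fin (n + 1))) (ι := Fin (n + 1)) (by simp)
      (v := fun _ => e) (s := {0}) (by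
        refine ⟨fun i => he, fun i j hij => (hij (Subsingleton.elim i j)).elim⟩)
    have hb0 : b 0 = e := hb 0 rfl
    refine ⟨(∫ y : EuclideanSpace ℝ (Fin n), halfChord y ^ (r + 1)) / (r + 1),
      2 * ∫ y : EuclideanSpace ℝ (Fin n), signedPow r (halfChord y),
      div_pos (integral_halfChord_rpow_pos hr) (by linarith),
      mul_pos two_pos (integral_signedPow_halfChord_pos hr), fun A a => ?_⟩
    have htr : ∑ i, inner ℝ (A (b i)) (b i) = ∑ i, A (EuclideanSpace.single i 1) i := by
      have h1 := LinearMap.trace_eq_sum_inner (A : _ →ₗ[ℝ] _) b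
      have h2 := LinearMap.trace_eq_sum_inner (A : _ →ₗ[ℝ] _)
        (EuclideanSpace.basisFun (Fin (n + 1)) ℝ)
      rw [h1] at h2
      calc ∑ i, inner ℝ (A (b i)) (b i) = ∑ i, inner ℝ (b i) (A (b i)) :=
            Finset.sum_congr rfl fun i _ => real_inner_comm _ _
        _ = ∑ i, A (EuclideanSpace.single i 1) i := by
          refine h2.trans (Finset.sum_congr rfl fun i _ => ?_)
          simp [EuclideanSpace.inner_single_left]
    have := tendsto_integral_signedPow_basis b hr A a
    rwa [htr, hb0] at this

end Coordinates

/-! ### Existence, uniqueness and comparison for the `p`-mean -/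

section PMean

variable {N : ℕ} {p : ℝ≥0∞} {u : EuclideanSpace ℝ (Fin N) → ℝ} {x : EuclideanSpace ℝ (Fin N)}
  {ε : ℝ}

/-- A nonempty relatively open subset of a closed ball has positive measure. -/
lemma restrict_closedBall_preimage_pos (hε : 0 < ε) (hu : ContinuousOn u (Metric.closedBall x ε))
    {V : Set ℝ} (hV : IsOpen V) {y : EuclideanSpace ℝ (Fin N)} (hy : y ∈ Metric.closedBall x ε)
    (hyV : u y ∈ V) : 0 < volume.restrict (Metric.closedBall x ε) (u ⁻¹' V) := by
  have hopen : IsOpen (Metric.ball x ε ∩ u ⁻¹' V) :=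
    (hu.mono Metric.ball_subset_closedBall).isOpen_inter_preimage Metric.isOpen_ball hV
  have hne : (Metric.ball x ε ∩ u ⁻¹' V).Nonempty := by
    have hcl : y ∈ closure (Metric.ball x ε) := by rwa [closure_ball x hε.ne']
    have hmem : u ⁻¹' V ∈ 𝓝[Metric.ball x ε] y :=
      ((hu y hy).mono Metric.ball_subset_closedBall) (hV.mem_nhds hyV)
    have := mem_closure_iff_nhdsWithin_neBot.1 hcl
    obtain ⟨z, hz1, hz2⟩ := (nonempty_of_mem (inter_mem self_mem_nhdsWithin hmem))
    exact ⟨z, hz1, hz2⟩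
  refine (hopen.measure_pos volume hne).trans_le ?_
  refine le_trans (measure_mono ?_) (Measure.le_restrict_apply _ _)
  exact fun z hz => ⟨hz.2, Metric.ball_subset_closedBall hz.1⟩

lemma integrableOn_abs_sub_rpow {r : ℝ} (hr : 1 ≤ r) (hu : ContinuousOn u (Metric.closedBall x ε))
    (c : ℝ) : IntegrableOn (fun y => |u y - c| ^ r) (Metric.closedBall x ε) :=
  ((continuous_abs_rpow hr).comp_continuousOn (hu.sub continuousOn_const)).integrableOn_compact
    (isCompact_closedBall _ _)

lemma integrableOn_signedPow_sub {r : ℝ} (hr : 1 ≤ r)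
    (hu : ContinuousOn u (Metric.closedBall x ε)) (c : ℝ) :
    IntegrableOn (fun y => signedPow r (u y - c)) (Metric.closedBall x ε) :=
  integrableOn_signedPow_comp hr (isCompact_closedBall _ _) measurableSet_closedBall
    (hu.sub continuousOn_const)

lemma one_le_toReal (hp : 1 ≤ p) (hpt : p ≠ ∞) : 1 ≤ p.toReal := by
  simpa using ENNReal.toReal_mono hpt hp

lemma isPMean_iff_integral_le (hp : 1 ≤ p) (hpt : p ≠ ∞)
    (hu : ContinuousOn u (Metric.closedBall x ε)) (m : ℝ) :
    IsPMean p u x ε m ↔ ∀ c : ℝ, ∫ y in Metric.closedBall x ε, |u y - m| ^ p.toReal ≤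
      ∫ y in Metric.closedBall x ε, |u y - c| ^ p.toReal := by
  have hr := one_le_toReal hp hpt
  have hp0 : p ≠ 0 := (one_pos.trans_le hp).ne'
  have hmem : ∀ c : ℝ, MemLp (fun y => u y - c) p (volume.restrict (Metric.closedBall x ε)) := by
    intro c
    have hc : ContinuousOn (fun y => u y - c) (Metric.closedBall x ε) :=
      hu.sub continuousOn_const
    obtain ⟨C, hC⟩ := (isCompact_closedBall x ε).exists_bound_of_continuousOn hc
    have : IsFiniteMeasure (volume.restrict (Metric.closedBall x ε)) :=
      ⟨by simpa using (isCompact_closedBall x ε).measure_lt_top⟩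
    refine MemLp.of_bound (hc.aestronglyMeasurable measurableSet_closedBall) C ?_
    filter_upwards [ae_restrict_mem measurableSet_closedBall] with y hy using hC y hy
  refine forall_congr' fun c => ?_
  have h0 : ∀ c : ℝ, 0 ≤ ∫ y in Metric.closedBall x ε, |u y - c| ^ p.toReal := fun c =>
    integral_nonneg fun y => by positivity
  rw [(hmem m).eLpNorm_eq_integral_rpow_norm hp0 hpt,
    (hmem c).eLpNorm_eq_integral_rpow_norm hp0 hpt]
  simp only [Real.norm_eq_abs]
  rw [ENNReal.ofReal_le_ofReal_iff (Real.rpow_nonneg (h0 c) _),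
    Real.rpow_le_rpow_iff (h0 m) (h0 c) (by positivity)]

lemma integral_abs_rpow_add_le {r : ℝ} (hr : 1 ≤ r) (hu : ContinuousOn u (Metric.closedBall x ε))
    (m c : ℝ) :
    (∫ y in Metric.closedBall x ε, |u y - c| ^ r) +
        r * (∫ y in Metric.closedBall x ε, signedPow r (u y - c)) * (c - m) ≤
      ∫ y in Metric.closedBall x ε, |u y - m| ^ r := by
  have h1 := integrableOn_abs_sub_rpow hr hu c
  have h2 := ((integrableOn_signedPow_sub hr hu c).const_mul r).mul_const (c - m)
  rw [← integral_const_mul, ← integral_mul_const, ← integral_add h1 h2]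
  refine integral_mono (h1.add h2) (integrableOn_abs_sub_rpow hr hu m) fun y => ?_
  have := abs_rpow_add_le hr (u y - m) (u y - c)
  have e : u y - m - (u y - c) = c - m := by ring
  rwa [e] at this

/-- The sign of the integral of `signedPow p (u - c)` tells on which side of `c` the `p`-mean
lies. -/
lemma IsPMean.le_of_integral_pos (hp : 1 ≤ p) (hpt : p ≠ ∞)
    (hu : ContinuousOn u (Metric.closedBall x ε)) {m c : ℝ} (hm : IsPMean p u x ε m)
    (hc : 0 < ∫ y in Metric.closedBall x ε, signedPow p.toReal (u y - c)) : c ≤ m := by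
  have hr := one_le_toReal hp hpt
  have h1 := integral_abs_rpow_add_le hr hu m c
  have h2 := (isPMean_iff_integral_le hp hpt hu m).1 hm c
  by_contra! h
  have : 0 < p.toReal * (∫ y in Metric.closedBall x ε, signedPow p.toReal (u y - c)) * (c - m) :=
    mul_pos (mul_pos (by linarith) hc) (by linarith)
  linarith

lemma IsPMean.le_of_integral_neg (hp : 1 ≤ p) (hpt : p ≠ ∞)
    (hu : ContinuousOn u (Metric.closedBall x ε)) {m c : ℝ} (hm : IsPMean p u x ε m)
    (hc : ∫ y in Metric.closedBall x ε, signedPow p.toReal (u y - c) < 0) : m ≤ c := by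
  have hr := one_le_toReal hp hpt
  have h1 := integral_abs_rpow_add_le hr hu m c
  have h2 := (isPMean_iff_integral_le hp hpt hu m).1 hm c
  by_contra! h
  have : 0 < p.toReal * (-∫ y in Metric.closedBall x ε, signedPow p.toReal (u y - c)) * (m - c) :=
    mul_pos (mul_pos (by linarith) (by linarith)) (by linarith)
  linarith

lemma exists_isPMean_of_ne_top (hp : 1 ≤ p) (hpt : p ≠ ∞) (hε : 0 < ε)
    (hu : ContinuousOn u (Metric.closedBall x ε)) : ∃ m, IsPMean p u x ε m := by
  have hr := one_le_toReal hp hpt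
  set r := p.toReal with hrdef
  have hne : (Metric.closedBall x ε).Nonempty := ⟨x, Metric.mem_closedBall_self hε.le⟩
  obtain ⟨y₁, hy₁, hmin⟩ := (isCompact_closedBall x ε).exists_isMinOn hne hu
  obtain ⟨y₂, hy₂, hmax⟩ := (isCompact_closedBall x ε).exists_isMaxOn hne hu
  have hle : u y₁ ≤ u y₂ := hmin hy₂
  have hcont : ContinuousOn (fun c => ∫ y in Metric.closedBall x ε, |u y - c| ^ r)
      (Set.Icc (u y₁) (u y₂)) := by
    refine continuousOn_of_dominated (bound := fun _ => (u y₂ - u y₁) ^ r)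
      (fun c _ => (integrableOn_abs_sub_rpow hr hu c).aestronglyMeasurable) (fun c hc => ?_)
      (integrableOn_const (isCompact_closedBall _ _).measure_lt_top.ne) ?_
    · filter_upwards [ae_restrict_mem measurableSet_closedBall] with y hy
      have h1 : u y₁ ≤ u y := hmin hy
      have h2 : u y ≤ u y₂ := hmax hy
      rw [Real.norm_of_nonneg (by positivity)]
      exact Real.rpow_le_rpow (abs_nonneg _)
        (abs_le.2 ⟨by linarith [hc.2], by linarith [hc.1]⟩) (by linarith)
    · refine Eventually.of_forall fun y => Continuous.continuousOn ?_
      exact (continuous_abs_rpow hr).comp (by fun_prop)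
  obtain ⟨m, hm, hmm⟩ := isCompact_Icc.exists_isMinOn (Set.nonempty_Icc.2 hle) hcont
  refine ⟨m, (isPMean_iff_integral_le hp hpt hu m).2 fun c => ?_⟩
  -- clamping `c` to the range of `u` does not increase any of the values `|u y - c|`
  set d := max (u y₁) (min c (u y₂)) with hd
  have hdm : d ∈ Set.Icc (u y₁) (u y₂) := ⟨le_max_left _ _, max_le hle (min_le_right _ _)⟩
  refine (hmm hdm).trans (setIntegral_mono_on (integrableOn_abs_sub_rpow hr hu d)
    (integrableOn_abs_sub_rpow hr hu c) measurableSet_closedBall fun y hy => ?_)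
  have h1 : u y₁ ≤ u y := hmin hy
  have h2 : u y ≤ u y₂ := hmax hy
  refine Real.rpow_le_rpow (abs_nonneg _) ?_ (by linarith)
  rcases le_total c (u y₂) with h | h
  · rw [hd, min_eq_left h]
    rcases le_total (u y₁) c with h' | h'
    · rw [max_eq_right h']
    · rw [max_eq_left h', abs_of_nonneg (by linarith), abs_of_nonneg (by linarith)]
      linarith
  · rw [hd, min_eq_right h, max_eq_right hle, abs_of_nonpos (by linarith),
      abs_of_nonpos (by linarith)]
    linarith

/-- The integral of `signedPow r (u - e)` is strictly decreasing in `e` across the values of `u`. -/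
lemma integral_signedPow_sub_lt {r : ℝ} (hr : 1 ≤ r) (hε : 0 < ε)
    (hu : ContinuousOn u (Metric.closedBall x ε)) {e₁ e₂ : ℝ} {y : EuclideanSpace ℝ (Fin N)}
    (hy : y ∈ Metric.closedBall x ε) (h₁ : e₁ < u y) (h₂ : u y < e₂) :
    ∫ y in Metric.closedBall x ε, signedPow r (u y - e₂) <
      ∫ y in Metric.closedBall x ε, signedPow r (u y - e₁) := by
  have hi₁ := integrableOn_signedPow_sub hr hu e₁
  have hi₂ := integrableOn_signedPow_sub hr hu e₂
  have hi : Integrable (fun y => signedPow r (u y - e₁) - signedPow r (u y - e₂))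
      (volume.restrict (Metric.closedBall x ε)) := hi₁.sub hi₂
  rw [← sub_pos, ← integral_sub hi₁ hi₂, integral_pos_iff_support_of_nonneg _ hi]
  · refine (restrict_closedBall_preimage_pos hε hu isOpen_Ioo hy ⟨h₁, h₂⟩).trans_le
      (measure_mono fun z hz => ?_)
    have h3 : 0 < signedPow r (u z - e₁) := signedPow_pos (by linarith [hz.1])
    have h4 : 0 < signedPow r (-(u z - e₂)) := signedPow_pos (by linarith [hz.2])
    rw [signedPow_neg] at h4
    simp only [Function.mem_support]
    linarith
  · intro z
    have : signedPow r (u z - e₂) ≤ signedPow r (u z - e₁) :=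
      monotone_signedPow hr (by linarith)
    simpa using this

lemma setIntegral_closedBall_pos (hε : 0 < ε) {f : EuclideanSpace ℝ (Fin N) → ℝ}
    (hf : IntegrableOn f (Metric.closedBall x ε)) (h : ∀ y ∈ Metric.closedBall x ε, 0 < f y) :
    0 < ∫ y in Metric.closedBall x ε, f y := by
  rw [setIntegral_pos_iff_support_of_nonneg_ae _ hf]
  · refine (Metric.measure_closedBall_pos volume x hε).trans_le (measure_mono fun y hy => ?_)
    exact ⟨(h y hy).ne', hy⟩
  · filter_upwards [ae_restrict_mem measurableSet_closedBall] with y hy using (h y hy).le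

/-- Uniqueness of the `p`-mean. Between two minimizers the integral of `signedPow p (u - e)` would
vanish for all `e`, so `u` would take values on both sides of the gap, hence, the ball being
connected, also inside of it, where the integral is strictly decreasing. -/
lemma IsPMean.not_lt (hp : 1 ≤ p) (hpt : p ≠ ∞) (hε : 0 < ε)
    (hu : ContinuousOn u (Metric.closedBall x ε)) {m d : ℝ} (hm : IsPMean p u x ε m)
    (hd : IsPMean p u x ε d) : ¬ m < d := by
  intro hlt
  have hr := one_le_toReal hp hpt
  have hzero : ∀ e, m < e → e < d →
      ∫ y in Metric.closedBall x ε, signedPow p.toReal (u y - e) = 0 := by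
    intro e he₁ he₂
    rcases lt_trichotomy (∫ y in Metric.closedBall x ε, signedPow p.toReal (u y - e)) 0
      with h | h | h
    · exact absurd (hd.le_of_integral_neg hp hpt hu h) (not_le.2 he₂)
    · exact h
    · exact absurd (hm.le_of_integral_pos hp hpt hu h) (not_le.2 he₁)
  obtain ⟨e₁, he₁, he₁'⟩ := exists_between hlt
  obtain ⟨e₂, he₂, he₂'⟩ := exists_between he₁'
  have hz₁ := hzero e₁ he₁ he₁'
  have hz₂ := hzero e₂ (he₁.trans he₂) he₂'
  obtain ⟨y₁, hy₁, hy₁'⟩ : ∃ y ∈ Metric.closedBall x ε, u y ≤ e₁ := by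
    by_contra! h
    have := setIntegral_closedBall_pos hε (integrableOn_signedPow_sub hr hu e₁)
      fun y hy => signedPow_pos (r := p.toReal) (sub_pos.2 (h y hy))
    linarith
  obtain ⟨y₂, hy₂, hy₂'⟩ : ∃ y ∈ Metric.closedBall x ε, e₂ ≤ u y := by
    by_contra! h
    have := setIntegral_closedBall_pos hε (integrableOn_signedPow_sub hr hu e₂).neg
      fun y hy => by
        have := signedPow_pos (r := p.toReal) (t := -(u y - e₂)) (by linarith [h y hy])
        rwa [signedPow_neg] at this
    simp only [Pi.neg_apply, integral_neg] at this
    linarith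
  have hconn : IsPreconnected (Metric.closedBall x ε) :=
    (convex_closedBall x ε).isPreconnected
  obtain ⟨y, hy, hye⟩ := hconn.intermediate_value hy₁ hy₂ hu
    (show (e₁ + e₂) / 2 ∈ Set.Icc (u y₁) (u y₂) from ⟨by linarith, by linarith⟩)
  have := integral_signedPow_sub_lt hr hε hu hy (e₁ := e₁) (e₂ := e₂) (by linarith) (by linarith)
  linarith

lemma eLpNorm_top_le_iff (hε : 0 < ε) (hu : ContinuousOn u (Metric.closedBall x ε)) {C : ℝ}
    (hC : 0 ≤ C) : eLpNorm u ∞ (volume.restrict (Metric.closedBall x ε)) ≤ ENNReal.ofReal C ↔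
      ∀ y ∈ Metric.closedBall x ε, |u y| ≤ C := by
  constructor
  · intro h y hy
    by_contra! hlt
    have hV : IsOpen {t : ℝ | C < |t|} := isOpen_lt continuous_const continuous_abs
    have hpos := restrict_closedBall_preimage_pos hε hu hV hy hlt
    rw [eLpNorm_exponent_top] at h
    have hae := enorm_ae_le_eLpNormEssSup u (volume.restrict (Metric.closedBall x ε))
    refine hpos.ne' (measure_mono_null (fun z hz => ?_) (ae_iff.1 hae))
    have hz' : C < |u z| := hz
    intro hle
    have h1 := hle.trans h
    rw [← ofReal_norm, ENNReal.ofReal_le_ofReal_iff hC, Real.norm_eq_abs] at h1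
    linarith
  · intro h
    rw [eLpNorm_exponent_top]
    refine eLpNormEssSup_le_of_ae_bound ?_
    filter_upwards [ae_restrict_mem measurableSet_closedBall] with y hy using h y hy

/-- The `∞`-mean is the mid-range. -/
lemma isPMean_top_iff (hε : 0 < ε) (hu : ContinuousOn u (Metric.closedBall x ε))
    {y₁ y₂ : EuclideanSpace ℝ (Fin N)} (hy₁ : y₁ ∈ Metric.closedBall x ε)
    (hy₂ : y₂ ∈ Metric.closedBall x ε) (hmin : ∀ y ∈ Metric.closedBall x ε, u y₁ ≤ u y)
    (hmax : ∀ y ∈ Metric.closedBall x ε, u y ≤ u y₂) (m : ℝ) :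
    IsPMean ∞ u x ε m ↔ m = (u y₁ + u y₂) / 2 := by
  have hc : ∀ c : ℝ, ContinuousOn (fun y => u y - c) (Metric.closedBall x ε) := fun c =>
    hu.sub continuousOn_const
  have hR : 0 ≤ (u y₂ - u y₁) / 2 := by linarith [hmin y₂ hy₂]
  have hmid : eLpNorm (fun y => u y - (u y₁ + u y₂) / 2) ∞
      (volume.restrict (Metric.closedBall x ε)) ≤ ENNReal.ofReal ((u y₂ - u y₁) / 2) := by
    rw [eLpNorm_top_le_iff hε (hc _) hR]
    intro y hy
    exact abs_le.2 ⟨by linarith [hmin y hy], by linarith [hmax y hy]⟩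
  constructor
  · intro hm
    have h := (eLpNorm_top_le_iff hε (hc m) hR).1 ((hm _).trans hmid)
    have h1 := (abs_le.1 (h y₁ hy₁)).1
    have h2 := (abs_le.1 (h y₂ hy₂)).2
    linarith
  · rintro rfl c
    refine hmid.trans ?_
    by_contra! hlt
    have hfin := hlt.ne_top
    rw [← ENNReal.ofReal_toReal hfin, ENNReal.ofReal_lt_ofReal_iff_of_nonneg
      ENNReal.toReal_nonneg] at hlt
    have h := (eLpNorm_top_le_iff hε (hc c) ENNReal.toReal_nonneg).1
      (ENNReal.ofReal_toReal hfin).ge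
    have h1 := (abs_le.1 (h y₁ hy₁)).1
    have h2 := (abs_le.1 (h y₂ hy₂)).2
    linarith

lemma existsUnique_isPMean (hp : 1 ≤ p) (hε : 0 < ε)
    (hu : ContinuousOn u (Metric.closedBall x ε)) : ∃! m, IsPMean p u x ε m := by
  by_cases hpt : p = ∞
  · subst hpt
    have hne : (Metric.closedBall x ε).Nonempty := ⟨x, Metric.mem_closedBall_self hε.le⟩
    obtain ⟨y₁, hy₁, hmin⟩ := (isCompact_closedBall x ε).exists_isMinOn hne hu
    obtain ⟨y₂, hy₂, hmax⟩ := (isCompact_closedBall x ε).exists_isMaxOn hne hu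
    simp_rw [isPMean_top_iff hε hu hy₁ hy₂ (fun y hy => hmin hy) (fun y hy => hmax hy)]
    exact existsUnique_eq
  · obtain ⟨m, hm⟩ := exists_isPMean_of_ne_top hp hpt hε hu
    refine ⟨m, hm, fun d hd => le_antisymm ?_ ?_⟩
    · exact not_lt.1 (hm.not_lt hp hpt hε hu hd)
    · exact not_lt.1 (hd.not_lt hp hpt hε hu hm)

lemma isPMean_pMean (hp : 1 ≤ p) (hε : 0 < ε)
    (hu : ContinuousOn u (Metric.closedBall x ε)) : IsPMean p u x ε (pMean p u x ε) :=
  Classical.epsilon_spec (existsUnique_isPMean hp hε hu).exists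

end PMean

/-! ### Taylor expansion and the normalized `p`-Laplacian -/

section Taylor

variable {N : ℕ} {u : EuclideanSpace ℝ (Fin N) → ℝ} {x : EuclideanSpace ℝ (Fin N)}

lemma hasFDerivAt_gradient (hu : ContDiffAt ℝ 2 u x) :
    HasFDerivAt (gradient u) (fderiv ℝ (gradient u) x) x := by
  have h1 : ContDiffAt ℝ 1 (fderiv ℝ u) x := hu.fderiv_right (by norm_num)
  have h2 : DifferentiableAt ℝ (fderiv ℝ u) x := h1.differentiableAt (by norm_num)
  have h3 : DifferentiableAt ℝ (gradient u) x :=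
    (InnerProductSpace.toDual ℝ (EuclideanSpace ℝ (Fin N))).symm.differentiableAt.comp x h2
  exact h3.hasFDerivAt

/-- Second-order Taylor expansion, by integrating the expansion of the gradient along rays. -/
lemma abs_sub_taylor_le (hu : ContDiffAt ℝ 2 u x) {η : ℝ} (hη : 0 < η) :
    ∀ᶠ ε : ℝ in 𝓝[>] 0, ∀ y ∈ Metric.closedBall x ε,
      |u y - u x - inner ℝ (gradient u x) (y - x) -
        2⁻¹ * inner ℝ (fderiv ℝ (gradient u) x (y - x)) (y - x)| ≤ η * ε ^ 2 := by
  set ξ := gradient u x with hξ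
  set A := fderiv ℝ (gradient u) x with hA
  have hdiff : ∀ᶠ y in 𝓝 x, DifferentiableAt ℝ u y := by
    filter_upwards [hu.eventually (by simp)] with y hy using hy.differentiableAt (by norm_num)
  have hgrad := (hasFDerivAt_gradient hu).isLittleO.def hη
  obtain ⟨δ, hδ, hball⟩ := Metric.eventually_nhds_iff_ball.1 (hdiff.and hgrad)
  filter_upwards [self_mem_nhdsWithin, mem_nhdsWithin_of_mem_nhds (Iio_mem_nhds hδ)]
    with ε hε hεδ y hy
  have hε0 : 0 < ε := hε
  have hyε : ‖y - x‖ ≤ ε := by rwa [mem_closedBall_iff_norm] at hy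
  set v := y - x with hv
  have hmem : ∀ s ∈ Set.Icc (0 : ℝ) 1, x + s • v ∈ Metric.ball x δ := by
    intro s hs
    rw [mem_ball_iff_norm, add_sub_cancel_left, norm_smul, Real.norm_of_nonneg hs.1]
    calc s * ‖v‖ ≤ 1 * ‖v‖ := by gcongr; exact hs.2
      _ < δ := by rw [one_mul]; exact hyε.trans_lt hεδ
  have hder : ∀ s ∈ Set.Icc (0 : ℝ) 1, HasDerivWithinAt
      (fun s : ℝ => u (x + s • v) - s * inner ℝ ξ v - s ^ 2 * (2⁻¹ * inner ℝ (A v) v))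
      (inner ℝ (gradient u (x + s • v) - ξ - A (s • v)) v) (Set.Icc 0 1) s := by
    intro s hs
    have h1 : HasDerivAt (fun s : ℝ => x + s • v) v s := by
      simpa using ((hasDerivAt_id s).smul_const v).const_add x
    have h2 := ((hball _ (hmem s hs)).1.hasFDerivAt.comp_hasDerivAt s h1)
    have h3 : fderiv ℝ u (x + s • v) v = inner ℝ (gradient u (x + s • v)) v := by
      simp [gradient]
    have h4 := (h2.sub ((hasDerivAt_id s).mul_const (inner ℝ ξ v))).sub
      (((hasDerivAt_id s).pow 2).mul_const (2⁻¹ * inner ℝ (A v) v))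
    refine (h4.congr_deriv ?_).hasDerivWithinAt
    rw [h3]
    simp only [inner_sub_left, map_smul, inner_smul_left, id, conj_trivial, Nat.cast_ofNat]
    ring
  have hbound : ∀ s ∈ Set.Ico (0 : ℝ) 1,
      ‖(inner ℝ (gradient u (x + s • v) - ξ - A (s • v)) v : ℝ)‖ ≤ η * ε ^ 2 := by
    intro s hs
    have h1 := (hball _ (hmem s (Set.Ico_subset_Icc_self hs))).2
    rw [add_sub_cancel_left] at h1
    have h2 : ‖s • v‖ ≤ ε := by
      rw [norm_smul, Real.norm_of_nonneg hs.1]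
      calc s * ‖v‖ ≤ 1 * ‖v‖ := by gcongr; exact hs.2.le
        _ ≤ ε := by rwa [one_mul]
    calc ‖(inner ℝ (gradient u (x + s • v) - ξ - A (s • v)) v : ℝ)‖
        ≤ ‖gradient u (x + s • v) - ξ - A (s • v)‖ * ‖v‖ := norm_inner_le_norm _ _
      _ ≤ (η * ‖s • v‖) * ‖v‖ := by gcongr
      _ ≤ (η * ε) * ε := by gcongr
      _ = η * ε ^ 2 := by ring
  have := norm_image_sub_le_of_norm_deriv_le_segment_01' hder hbound
  have hxy : x + (1 : ℝ) • v = y := by simp [hv]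
  simp only [hxy, zero_smul, add_zero, Real.norm_eq_abs] at this
  refine le_trans (le_of_eq ?_) this
  congr 1
  ring

lemma normalizedPLaplacian_of_ne_top {p : ℝ≥0∞} (hpt : p ≠ ∞) (hu : ContDiffAt ℝ 2 u x)
    (hξ : gradient u x ≠ 0) :
    normalizedPLaplacian p u x =
      ∑ i, fderiv ℝ (gradient u) x (EuclideanSpace.single i 1) i +
        (p.toReal - 2) * inner ℝ (fderiv ℝ (gradient u) x (‖gradient u x‖⁻¹ • gradient u x))
          (‖gradient u x‖⁻¹ • gradient u x) := by
  rw [normalizedPLaplacian, if_neg hpt, divergence]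
  set s := p.toReal - 2
  set A := fderiv ℝ (gradient u) x with hA
  have hg := hasFDerivAt_gradient hu
  set ξ := gradient u x with hξdef
  have hn : 0 < ‖ξ‖ := norm_pos_iff.2 hξ
  have hnorm : HasFDerivAt (fun y => ‖gradient u y‖ ^ s)
      ((s * ‖ξ‖ ^ (s - 2)) • (innerSL ℝ ξ).comp A) x := by
    have h1 := (hg.norm_sq).rpow_const (p := s / 2) (Or.inl (by positivity))
    have e : (fun y => ‖gradient u y‖ ^ s) = fun y => (‖gradient u y‖ ^ 2) ^ (s / 2) := by
      ext y
      rw [← Real.rpow_natCast, ← Real.rpow_mul (norm_nonneg _)]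
      congr 1
      push_cast
      ring
    rw [e]
    refine h1.congr_fderiv ?_
    have e2 : (‖ξ‖ ^ 2) ^ (s / 2 - 1) = ‖ξ‖ ^ (s - 2) := by
      rw [← Real.rpow_natCast, ← Real.rpow_mul (norm_nonneg _)]
      congr 1
      push_cast
      ring
    ext v
    simp only [← hξdef, e2, smul_apply, smul_eq_mul, nsmul_eq_mul,
      Nat.cast_ofNat]
    ring
  have hV : HasFDerivAt (fun y => ‖gradient u y‖ ^ s • gradient u y)
      (‖ξ‖ ^ s • A + ((s * ‖ξ‖ ^ (s - 2)) • (innerSL ℝ ξ).comp A).smulRight ξ) x := hnorm.smul hg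
  rw [hV.fderiv]
  have hpow : ‖ξ‖ ^ (s - 2) = ‖ξ‖ ^ s / ‖ξ‖ ^ 2 := by
    rw [Real.rpow_sub hn]; norm_num
  have hs0 : 0 < ‖ξ‖ ^ s := by positivity
  have hsum : ∑ i, inner ℝ ξ (A (EuclideanSpace.single i 1)) * ξ i = inner ℝ (A ξ) ξ := by
    have hξsum : ξ = ∑ i, ξ i • EuclideanSpace.single i (1 : ℝ) := by
      have := (EuclideanSpace.basisFun (Fin N) ℝ).sum_repr ξ
      simpa using this.symm
    have hAξ : A ξ = ∑ i, ξ i • A (EuclideanSpace.single i (1 : ℝ)) := by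
      conv_lhs => rw [hξsum]
      simp only [map_sum, map_smul]
    rw [real_inner_comm, hAξ, inner_sum]
    refine Finset.sum_congr rfl fun i _ => ?_
    rw [inner_smul_right]
    ring
  have hterm : ∀ i : Fin N, ((‖ξ‖ ^ s • A +
      ((s * ‖ξ‖ ^ (s - 2)) • (innerSL ℝ ξ).comp A).smulRight ξ)
        (EuclideanSpace.single i (1 : ℝ))) i =
      ‖ξ‖ ^ s * (A (EuclideanSpace.single i 1) i) + s * (‖ξ‖ ^ s / ‖ξ‖ ^ 2) *
        (inner ℝ ξ (A (EuclideanSpace.single i 1)) * ξ i) := by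
    intro i
    rw [← hpow]
    simp
    ring
  rw [Finset.sum_congr rfl fun i _ => hterm i, Finset.sum_add_distrib, ← Finset.mul_sum,
    ← Finset.mul_sum, hsum, map_smul, inner_smul_left, inner_smul_right, conj_trivial]
  field_simp

end Taylor

/-! ### Second-order expansion of the `p`-mean -/

section Expansion

variable {N : ℕ} {x : EuclideanSpace ℝ (Fin N)}

/-- Rescaling to the unit ball. -/
lemma integral_closedBall_eq {ε : ℝ} (hε : 0 < ε) (f : EuclideanSpace ℝ (Fin N) → ℝ) :
    ∫ y in Metric.closedBall x ε, f (y - x) =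
      ε ^ N * ∫ z in Metric.closedBall (0 : EuclideanSpace ℝ (Fin N)) 1, f (ε • z) := by
  have h1 : ∫ y in Metric.closedBall x ε, f (y - x) =
      ∫ y in Metric.closedBall (0 : EuclideanSpace ℝ (Fin N)) ε, f y := by
    have := (measurePreserving_sub_right (volume : Measure (EuclideanSpace ℝ (Fin N))) x)
      |>.setIntegral_preimage_emb (measurableEmbedding_subRight x) f (Metric.closedBall 0 ε)
    rw [← this]
    congr 2
    ext y
    simp [dist_eq_norm]
  rw [h1, Measure.setIntegral_comp_smul_of_pos volume f _ hε, smul_unitClosedBall,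
    Real.norm_of_nonneg hε.le, finrank_euclideanSpace_fin, smul_eq_mul]
  field_simp

lemma integral_signedPow_quadratic {r ε : ℝ} (hε : 0 < ε) {ξ : EuclideanSpace ℝ (Fin N)}
    (hξ : ξ ≠ 0) (A : EuclideanSpace ℝ (Fin N) →L[ℝ] EuclideanSpace ℝ (Fin N)) (a : ℝ) :
    ∫ y in Metric.closedBall x ε,
        signedPow r (inner ℝ ξ (y - x) + 2⁻¹ * inner ℝ (A (y - x)) (y - x) - a * ε ^ 2) =
      ε ^ N * (ε * ‖ξ‖) ^ (r - 1) *
        ∫ z in Metric.closedBall (0 : EuclideanSpace ℝ (Fin N)) 1,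
          signedPow r (inner ℝ (‖ξ‖⁻¹ • ξ) z +
            ε * (2⁻¹ * inner ℝ ((‖ξ‖⁻¹ • A) z) z - a / ‖ξ‖)) := by
  have hn : 0 < ‖ξ‖ := norm_pos_iff.2 hξ
  rw [integral_closedBall_eq hε
    (fun v => signedPow r (inner ℝ ξ v + 2⁻¹ * inner ℝ (A v) v - a * ε ^ 2)), mul_assoc]
  congr 1
  rw [← integral_const_mul]
  refine integral_congr_ae (Eventually.of_forall fun z => ?_)
  simp only
  rw [← signedPow_mul (by positivity : 0 < ε * ‖ξ‖)]
  congr 1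
  simp only [map_smul, smul_apply, inner_smul_left, inner_smul_right, conj_trivial]
  field_simp
  ring

/-- The `p`-mean has the second-order expansion `u x + κ * Δ u x * ε ^ 2 + o(ε ^ 2)`, `p < ∞`. -/
lemma exists_tendsto_pMean_of_ne_top {p : ℝ≥0∞} (hp : 1 ≤ p) (hpt : p ≠ ∞)
    {u : EuclideanSpace ℝ (Fin N) → ℝ} (hu : ContDiffAt ℝ 2 u x) (hξ : gradient u x ≠ 0)
    (hcont : ∀ᶠ ε : ℝ in 𝓝[>] 0, ContinuousOn u (Metric.closedBall x ε)) :
    ∃ κ : ℝ, 0 < κ ∧ Tendsto (fun ε : ℝ => (pMean p u x ε - u x) / ε ^ 2) (𝓝[>] 0)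
      (𝓝 (κ * normalizedPLaplacian p u x)) := by
  have hr := one_le_toReal hp hpt
  rw [normalizedPLaplacian_of_ne_top hpt hu hξ]
  set r := p.toReal with hrdef
  set ξ := gradient u x with hξdef
  set A := fderiv ℝ (gradient u) x with hA
  have hn : 0 < ‖ξ‖ := norm_pos_iff.2 hξ
  have he : ‖(‖ξ‖⁻¹ • ξ)‖ = 1 := by
    rw [norm_smul, norm_inv, norm_norm, inv_mul_cancel₀ hn.ne']
  set e := ‖ξ‖⁻¹ • ξ with he_def
  obtain ⟨M, K, hM, hK, hlim⟩ := exists_tendsto_integral_signedPow_ball hr he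
  set Δ := ∑ i, A (EuclideanSpace.single i 1) i + (r - 2) * inner ℝ (A e) e with hΔ
  have hlim' : ∀ a : ℝ, Tendsto (fun ε : ℝ => ε⁻¹ *
      ∫ z in Metric.closedBall (0 : EuclideanSpace ℝ (Fin N)) 1,
          signedPow r (inner ℝ e z + ε * (2⁻¹ * inner ℝ ((‖ξ‖⁻¹ • A) z) z - a / ‖ξ‖))) (𝓝[>] 0)
      (𝓝 (‖ξ‖⁻¹ * K * (M / K * Δ - a))) := by
    intro a
    convert hlim (‖ξ‖⁻¹ • A) (a / ‖ξ‖) using 2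
    have h1 : ∑ i, (‖ξ‖⁻¹ • A) (EuclideanSpace.single i 1) i =
        ‖ξ‖⁻¹ * ∑ i, A (EuclideanSpace.single i 1) i := by
      rw [Finset.mul_sum]
      exact Finset.sum_congr rfl fun i _ => by simp
    rw [h1, smul_apply, inner_smul_left, conj_trivial, hΔ]
    field_simp
  have hqcont : ∀ b : ℝ, Continuous fun y : EuclideanSpace ℝ (Fin N) =>
      inner ℝ ξ (y - x) + 2⁻¹ * inner ℝ (A (y - x)) (y - x) - b := by
    intro b; fun_prop
  have hqint : ∀ (b ε : ℝ), IntegrableOn (fun y => signedPow r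
      (inner ℝ ξ (y - x) + 2⁻¹ * inner ℝ (A (y - x)) (y - x) - b)) (Metric.closedBall x ε) :=
    fun b ε => integrableOn_signedPow_comp hr (isCompact_closedBall _ _) measurableSet_closedBall
      (hqcont b).continuousOn
  have hupper : ∀ a, M / K * Δ < a → ∀ᶠ ε : ℝ in 𝓝[>] 0, (pMean p u x ε - u x) / ε ^ 2 ≤ a := by
    intro a ha
    obtain ⟨a', ha', haa'⟩ := exists_between ha
    have hneg := (hlim' a').eventually_lt_const
      (mul_neg_of_pos_of_neg (mul_pos (inv_pos.2 hn) hK) (by linarith))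
    filter_upwards [self_mem_nhdsWithin, hneg, hcont, abs_sub_taylor_le hu (sub_pos.2 haa')]
      with ε hε hε1 hε2 hε3
    have hε0 : 0 < ε := hε
    have hI : ∫ y in Metric.closedBall x ε, signedPow r
        (inner ℝ ξ (y - x) + 2⁻¹ * inner ℝ (A (y - x)) (y - x) - a' * ε ^ 2) < 0 := by
      rw [integral_signedPow_quadratic hε0 hξ]
      exact mul_neg_of_pos_of_neg (by positivity)
        (neg_of_mul_neg_right hε1 (inv_pos.2 hε0).le)
    have hle := (isPMean_pMean hp hε0 hε2).le_of_integral_neg hp hpt hε2 (c := u x + a * ε ^ 2)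
      (lt_of_le_of_lt (setIntegral_mono_on (integrableOn_signedPow_sub hr hε2 _) (hqint _ ε)
        measurableSet_closedBall fun y hy => monotone_signedPow hr (by
          have := (abs_le.1 (hε3 y hy)).2
          linarith)) hI)
    rw [div_le_iff₀ (by positivity)]
    linarith
  have hlower : ∀ a, a < M / K * Δ → ∀ᶠ ε : ℝ in 𝓝[>] 0, a ≤ (pMean p u x ε - u x) / ε ^ 2 := by
    intro a ha
    obtain ⟨a', haa', ha'⟩ := exists_between ha
    have hpos := (hlim' a').eventually_const_lt
      (mul_pos (mul_pos (inv_pos.2 hn) hK) (by linarith))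
    filter_upwards [self_mem_nhdsWithin, hpos, hcont, abs_sub_taylor_le hu (sub_pos.2 haa')]
      with ε hε hε1 hε2 hε3
    have hε0 : 0 < ε := hε
    have hI : 0 < ∫ y in Metric.closedBall x ε, signedPow r
        (inner ℝ ξ (y - x) + 2⁻¹ * inner ℝ (A (y - x)) (y - x) - a' * ε ^ 2) := by
      rw [integral_signedPow_quadratic hε0 hξ]
      exact mul_pos (by positivity) ((mul_pos_iff_of_pos_left (inv_pos.2 hε0)).1 hε1)
    have hle := (isPMean_pMean hp hε0 hε2).le_of_integral_pos hp hpt hε2 (c := u x + a * ε ^ 2)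
      (lt_of_lt_of_le hI (setIntegral_mono_on (hqint _ ε) (integrableOn_signedPow_sub hr hε2 _)
        measurableSet_closedBall fun y hy => monotone_signedPow hr (by
          have := (abs_le.1 (hε3 y hy)).1
          linarith)))
    rw [le_div_iff₀ (by positivity)]
    linarith
  refine ⟨M / K, div_pos hM hK, tendsto_order.2 ⟨fun a ha => ?_, fun a ha => ?_⟩⟩
  · obtain ⟨a', haa', ha'⟩ := exists_between ha
    filter_upwards [hlower a' ha'] with ε hε using haa'.trans_le hε
  · obtain ⟨a', ha', haa'⟩ := exists_between ha
    filter_upwards [hupper a' ha'] with ε hε using hε.trans_lt haa'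

/-- Over a ball of radius `ε`, a linear function perturbed by a quadratic form is maximal at the
pole `ε • e` up to an error of order `ε ^ 3`. -/
lemma linear_add_quadratic_le {e : EuclideanSpace ℝ (Fin N)} (he : ‖e‖ = 1) {c ε : ℝ} (hc : 0 < c)
    (hε : 0 < ε) (A : EuclideanSpace ℝ (Fin N) →L[ℝ] EuclideanSpace ℝ (Fin N))
    {v : EuclideanSpace ℝ (Fin N)} (hv : ‖v‖ ≤ ε) :
    c * inner ℝ e v + 2⁻¹ * inner ℝ (A v) v ≤
      c * ε + 2⁻¹ * inner ℝ (A e) e * ε ^ 2 + ‖A‖ ^ 2 / (2 * c) * ε ^ 3 := by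
  set w := v - ε • e with hw
  have hε' : ‖ε • e‖ = ε := by rw [norm_smul, he, Real.norm_of_nonneg hε.le, mul_one]
  -- the loss in the linear term is quadratic in the distance from the pole
  have hlin : inner ℝ e v ≤ ε - ‖w‖ ^ 2 / (2 * ε) := by
    have h1 : ‖w‖ ^ 2 = ‖v‖ ^ 2 - 2 * (ε * inner ℝ e v) + ε ^ 2 := by
      rw [hw, norm_sub_sq_real, hε', inner_smul_right, real_inner_comm]
    have h2 : ‖v‖ ^ 2 ≤ ε ^ 2 := by gcongr
    have h3 : ε * inner ℝ e v ≤ ε * (ε - ‖w‖ ^ 2 / (2 * ε)) := by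
      have : ε * (ε - ‖w‖ ^ 2 / (2 * ε)) = ε ^ 2 - ‖w‖ ^ 2 / 2 := by field_simp
      rw [this]
      linarith
    exact le_of_mul_le_mul_left h3 hε
  have hquad : inner ℝ (A v) v ≤ inner ℝ (A e) e * ε ^ 2 + 2 * ‖A‖ * ε * ‖w‖ := by
    have h1 : inner ℝ (A v) v = inner ℝ (A e) e * ε ^ 2 + inner ℝ (A v) w +
        inner ℝ (A w) (ε • e) := by
      have hve : v = w + ε • e := by rw [hw]; abel
      have h2 : inner ℝ (A v) v = inner ℝ (A v) w + inner ℝ (A v) (ε • e) := by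
        rw [← inner_add_right, ← hve]
      have h3 : inner ℝ (A v) (ε • e) = inner ℝ (A w) (ε • e) + inner ℝ (A e) e * ε ^ 2 := by
        conv_lhs => rw [hve]
        rw [map_add, inner_add_left, map_smul, inner_smul_left, inner_smul_right, conj_trivial]
        rw [inner_smul_right]
        ring
      rw [h2, h3]
      ring
    have h2 : inner ℝ (A v) w ≤ ‖A‖ * ε * ‖w‖ := by
      refine (real_inner_le_norm _ _).trans ?_
      gcongr
      exact (A.le_opNorm v).trans (by gcongr)
    have h3 : inner ℝ (A w) (ε • e) ≤ ‖A‖ * ‖w‖ * ε := by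
      refine (real_inner_le_norm _ _).trans ?_
      rw [hε']
      gcongr
      exact A.le_opNorm w
    linarith
  have hsq : ‖A‖ * ε * ‖w‖ - c * (‖w‖ ^ 2 / (2 * ε)) ≤ ‖A‖ ^ 2 / (2 * c) * ε ^ 3 := by
    have h1 : ‖A‖ ^ 2 / (2 * c) * ε ^ 3 - (‖A‖ * ε * ‖w‖ - c * (‖w‖ ^ 2 / (2 * ε))) =
        (‖A‖ * ε ^ 2 - c * ‖w‖) ^ 2 / (2 * c * ε) := by
      field_simp
      ring
    have h2 : 0 ≤ (‖A‖ * ε ^ 2 - c * ‖w‖) ^ 2 / (2 * c * ε) := by positivity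
    linarith
  have hlin' : c * inner ℝ e v ≤ c * (ε - ‖w‖ ^ 2 / (2 * ε)) := by gcongr
  linarith

/-- The `∞`-mean has the second-order expansion `u x + Δ u x / 2 * ε ^ 2 + o(ε ^ 2)`. -/
lemma tendsto_pMean_top {u : EuclideanSpace ℝ (Fin N) → ℝ} (hu : ContDiffAt ℝ 2 u x)
    (hξ : gradient u x ≠ 0)
    (hcont : ∀ᶠ ε : ℝ in 𝓝[>] 0, ContinuousOn u (Metric.closedBall x ε)) :
    Tendsto (fun ε : ℝ => (pMean ∞ u x ε - u x) / ε ^ 2) (𝓝[>] 0)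
      (𝓝 (2⁻¹ * normalizedPLaplacian ∞ u x)) := by
  rw [normalizedPLaplacian, if_pos rfl]
  set ξ := gradient u x with hξdef
  set A := fderiv ℝ (gradient u) x with hA
  have hn : 0 < ‖ξ‖ := norm_pos_iff.2 hξ
  have he : ‖(‖ξ‖⁻¹ • ξ)‖ = 1 := by
    rw [norm_smul, norm_inv, norm_norm, inv_mul_cancel₀ hn.ne']
  set e := ‖ξ‖⁻¹ • ξ with he_def
  have hξe : ∀ v, inner ℝ ξ v = ‖ξ‖ * inner ℝ e v := by
    intro v
    rw [he_def, inner_smul_left, conj_trivial, mul_inv_cancel_left₀ hn.ne']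
  have hΔ : inner ℝ (A ξ) ξ / ‖ξ‖ ^ 2 = inner ℝ (A e) e := by
    rw [he_def, map_smul, inner_smul_left, inner_smul_right, conj_trivial]
    field_simp
  rw [hΔ]
  set q := inner ℝ (A e) e with hq
  set C := ‖A‖ ^ 2 / (2 * ‖ξ‖) with hC
  clear_value e
  have hkey : ∀ η > 0, ∀ᶠ ε : ℝ in 𝓝[>] 0,
      |(pMean ∞ u x ε - u x) / ε ^ 2 - 2⁻¹ * q| ≤ η + C * ε := by
    intro η hη
    filter_upwards [self_mem_nhdsWithin, hcont, abs_sub_taylor_le hu hη] with ε hε hε2 hε3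
    have hε0 : 0 < ε := hε
    have hne : (Metric.closedBall x ε).Nonempty := ⟨x, Metric.mem_closedBall_self hε0.le⟩
    obtain ⟨y₁, hy₁, hmin⟩ := (isCompact_closedBall x ε).exists_isMinOn hne hε2
    obtain ⟨y₂, hy₂, hmax⟩ := (isCompact_closedBall x ε).exists_isMaxOn hne hε2
    have hm := (isPMean_top_iff hε0 hε2 hy₁ hy₂ (fun y hy => hmin hy) (fun y hy => hmax hy) _).1
      (isPMean_pMean le_top hε0 hε2)
    have hee : inner ℝ e e = (1 : ℝ) := by rw [real_inner_self_eq_norm_sq, he]; norm_num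
    have hpole : ∀ s : ℝ, |s| = ε → x + s • e ∈ Metric.closedBall x ε := by
      intro s hs
      rw [mem_closedBall_iff_norm, add_sub_cancel_left, norm_smul, he, mul_one, Real.norm_eq_abs,
        hs]
    have hval : ∀ s : ℝ, |s| = ε →
        |u (x + s • e) - u x - ‖ξ‖ * s - 2⁻¹ * q * ε ^ 2| ≤ η * ε ^ 2 := by
      intro s hs
      have h1 := hε3 _ (hpole s hs)
      rw [add_sub_cancel_left] at h1
      refine le_trans (le_of_eq ?_) h1
      rw [hξe, map_smul, inner_smul_left, inner_smul_right, inner_smul_right, conj_trivial, hee,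
        ← hs, sq_abs]
      congr 1
      ring
    have hmaxlow : u x + ‖ξ‖ * ε + 2⁻¹ * q * ε ^ 2 - η * ε ^ 2 ≤ u y₂ := by
      have h1 := (abs_le.1 (hval ε (abs_of_pos hε0))).1
      have h2 : u (x + ε • e) ≤ u y₂ := hmax (hpole ε (abs_of_pos hε0))
      linarith
    have hminup : u y₁ ≤ u x - ‖ξ‖ * ε + 2⁻¹ * q * ε ^ 2 + η * ε ^ 2 := by
      have hs : |(-ε)| = ε := by rw [abs_neg, abs_of_pos hε0]
      have h1 := (abs_le.1 (hval (-ε) hs)).2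
      have h2 : u y₁ ≤ u (x + (-ε) • e) := hmin (hpole (-ε) hs)
      linarith
    have hmaxup : u y₂ ≤ u x + ‖ξ‖ * ε + 2⁻¹ * q * ε ^ 2 + C * ε ^ 3 + η * ε ^ 2 := by
      have h1 := (abs_le.1 (hε3 y₂ hy₂)).2
      have h2 := linear_add_quadratic_le he hn hε0 A (mem_closedBall_iff_norm.1 hy₂)
      rw [hξe] at h1
      linarith
    have hminlow : u x - ‖ξ‖ * ε + 2⁻¹ * q * ε ^ 2 - C * ε ^ 3 - η * ε ^ 2 ≤ u y₁ := by
      have h1 := (abs_le.1 (hε3 y₁ hy₁)).1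
      -- the minimum is the maximum for the reflected point and the opposite form
      have h2 := linear_add_quadratic_le he hn hε0 (-A) (v := -(y₁ - x))
        (by rw [norm_neg]; exact mem_closedBall_iff_norm.1 hy₁)
      simp only [neg_apply, inner_neg_right, map_neg, inner_neg_left, neg_neg,
        norm_neg] at h2
      rw [hξe] at h1
      linarith
    have e1 : (pMean ∞ u x ε - u x) / ε ^ 2 - 2⁻¹ * q =
        (pMean ∞ u x ε - u x - 2⁻¹ * q * ε ^ 2) / ε ^ 2 := by
      field_simp
    rw [e1, abs_div, abs_of_pos (by positivity : 0 < ε ^ 2), div_le_iff₀ (by positivity), hm]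
    have e2 : (η + C * ε) * ε ^ 2 = η * ε ^ 2 + C * ε ^ 3 := by ring
    rw [e2]
    have hC0 : 0 ≤ C * ε ^ 3 := by positivity
    exact abs_le.2 ⟨by linarith, by linarith⟩
  rw [Metric.tendsto_nhds]
  intro η hη
  have hsmall : Tendsto (fun ε : ℝ => C * ε) (𝓝[>] 0) (𝓝 0) := by
    have : Continuous fun ε : ℝ => C * ε := by fun_prop
    simpa using (this.tendsto 0).mono_left nhdsWithin_le_nhds
  filter_upwards [hkey (η / 2) (by positivity),
    hsmall.eventually_lt_const (by positivity : 0 < η / 2)] with ε h1 h2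
  rw [Real.dist_eq]
  linarith

lemma exists_tendsto_pMean {p : ℝ≥0∞} (hp : 1 ≤ p)
    {u : EuclideanSpace ℝ (Fin N) → ℝ} (hu : ContDiffAt ℝ 2 u x) (hξ : gradient u x ≠ 0)
    (hcont : ∀ᶠ ε : ℝ in 𝓝[>] 0, ContinuousOn u (Metric.closedBall x ε)) :
    ∃ κ : ℝ, 0 < κ ∧ Tendsto (fun ε : ℝ => (pMean p u x ε - u x) / ε ^ 2) (𝓝[>] 0)
      (𝓝 (κ * normalizedPLaplacian p u x)) := by
  by_cases hpt : p = ∞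
  · subst hpt
    exact ⟨2⁻¹, by norm_num, tendsto_pMean_top hu hξ hcont⟩
  · exact exists_tendsto_pMean_of_ne_top hp hpt hu hξ hcont

end Expansion

end PMeanValue

theorem corollary3p3 {N : ℕ} (p : ℝ≥0∞) (hp : 1 ≤ p)
    (Ω : Set (EuclideanSpace ℝ (Fin N))) (hΩ : IsOpen Ω)
    (u : EuclideanSpace ℝ (Fin N) → ℝ) (hu : ContDiffOn ℝ 2 u Ω) :
    (∀ x ∈ Ω, ∀ ε : ℝ, 0 < ε → Metric.closedBall x ε ⊆ Ω →
      ∃! m : ℝ, PMeanValue.IsPMean p u x ε m) ∧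
    (∀ x ∈ Ω, gradient u x ≠ 0 →
      (PMeanValue.normalizedPLaplacian p u x = 0 ↔
        (fun ε : ℝ => u x - PMeanValue.pMean p u x ε) =o[𝓝[>] (0 : ℝ)] (fun ε : ℝ => ε ^ 2))) := by
  refine ⟨fun x _ ε hε hsub =>
    PMeanValue.existsUnique_isPMean hp hε (hu.continuousOn.mono hsub), fun x hx hξ => ?_⟩
  have hcont : ∀ᶠ ε : ℝ in 𝓝[>] 0, ContinuousOn u (Metric.closedBall x ε) := by
    obtain ⟨δ, hδ, hball⟩ := Metric.isOpen_iff.1 hΩ x hx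
    filter_upwards [mem_nhdsWithin_of_mem_nhds (Iio_mem_nhds hδ)] with ε hε
    exact hu.continuousOn.mono ((Metric.closedBall_subset_ball hε).trans hball)
  obtain ⟨κ, hκ, hlim⟩ :=
    PMeanValue.exists_tendsto_pMean hp (hu.contDiffAt (hΩ.mem_nhds hx)) hξ hcont
  have hne : ∀ᶠ ε : ℝ in 𝓝[>] 0, ε ^ 2 = 0 → u x - PMeanValue.pMean p u x ε = 0 := by
    filter_upwards [self_mem_nhdsWithin] with ε hε h0
    exact absurd h0 (pow_ne_zero 2 (ne_of_gt hε))
  have hlim' : Tendsto (fun ε : ℝ => (u x - PMeanValue.pMean p u x ε) / ε ^ 2) (𝓝[>] 0)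
      (𝓝 (-(κ * PMeanValue.normalizedPLaplacian p u x))) := by
    refine hlim.neg.congr fun ε => ?_
    ring
  rw [isLittleO_iff_tendsto' hne]
  constructor
  · intro h
    simpa [h] using hlim'
  · intro h
    have := tendsto_nhds_unique h hlim'
    exact (mul_eq_zero.1 (neg_eq_zero.1 this.symm)).resolve_left hκ.ne'
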